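/- Let $\mathfrak g$ be a finite-dimensional complex semisimple Lie algebra with Killing form $B$, and let $\lambda\in\mathfrak g^*$ be semisimple. Let $\lambda^\sharp\in\mathfrak g$ be the element with $B(\lambda^\sharp,\cdot)=\lambda$, let $\mathfrak h$ be a Cartan subalgebra containing $\lambda^\sharp$, let $\Delta$ be its root system with root spaces $\mathfrak g^\alpha$, and write $(\cdot,\cdot)$ for the bilinear form on $\mathfrak h^*$ induced by $B$; we also write $\lambda$ for $\lambda|_{\mathfrak h}$. Put $\Delta'=\{\alpha\in\Delta\mid(\alpha,\lambda)=0\}$ and $\hat\Delta=\Delta\setminus\Delta'$. Fix an ordering of $\Delta$ with positive roots $\Delta^+$ (that is, $\Delta=\Delta^+\sqcup-\Delta^+$, and if the sum of two positive roots is a root, it is positive) which is invariant: if $\alpha\in\hat\Delta^+:=\hat\Delta\cap\Delta^+$, $\beta\in\Delta'$ and $\alpha+\beta\in\Delta$, then $\alpha+\beta\in\hat\Delta^+$. Put $$\mathfrak n^\pm=\bigoplus_{\alpha\in\Delta^+}\mathfrak g^{\pm\alpha},\qquad \tilde{\mathfrak n}^\pm=\bigoplus_{\alpha\in\hat\Delta^+}\mathfrak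 g^{\pm\alpha},$$ and let $\mathfrak g_\lambda=\{X\in\mathfrak g\mid\lambda([X,Y])=0\ \forall Y\in\mathfrak g\}$ be the stabilizer of $\lambda$. Let $\mathbb C_\lambda=\mathbb C\eta_\lambda$ and $\mathbb C^*_\lambda=\mathbb C\eta^*_\lambda$ be the one-dimensional representations of $\mathfrak g_\lambda\oplus\tilde{\mathfrak n}^+$ and $\mathfrak g_\lambda\oplus\tilde{\mathfrak n}^-$ on which $\mathfrak g_\lambda$ acts by $\lambda$ and $\tilde{\mathfrak n}^\pm$ acts by zero. Let $\tilde M_\lambda=U\mathfrak g\otimes_{U(\mathfrak g_\lambda\oplus\tilde{\mathfrak n}^+)}\mathbb C_\lambda$ and $\tilde M_\lambda^*=\mathbb C_\lambda^*\otimes_{U(\mathfrak g_\lambda\oplus\tilde{\mathfrak n}^-)}U\mathfrak g$ be the generalized Verma modules, and identify $\tilde M^*_\lambda\otimes_{U\mathfrak g}\tilde M_\lambda\cong\mathbb C$ by $\eta_\lambda^*\otimes\eta_\lambda\mapsto1$. With the antipode $S$, the generalized Shapovalov pairing is $$\langle\cdot,\cdot\rangle_{\sim,\lambda}:U(\tilde{\mathfrak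 n}^+)\times U(\tilde{\mathfrak n}^-)\to\mathbb C,\qquad \langle u,v\rangle_{\sim,\lambda}=(\eta_\lambda^*\otimes S(u))\otimes(v\otimes\eta_\lambda).$$ Let $\pi^-:U(\mathfrak n^-)\to U(\tilde{\mathfrak n}^-)$ and $\pi^+:U(\mathfrak n^+)\to U(\tilde{\mathfrak n}^+)$ be the projections determined by $\pi^-(v)\otimes\eta_\lambda=v\otimes\eta_\lambda$ in $\tilde M_\lambda$ and $\eta_\lambda^*\otimes S(\pi^+(u))=\eta_\lambda^*\otimes S(u)$ in $\tilde M_\lambda^*$. Let $\alpha_1,\dots,\alpha_k$ be the positive roots, choose $X_i\in\mathfrak g^{\alpha_i}$ and $Y_i\in\mathfrak g^{-\alpha_i}$ with $B(X_i,Y_i)=1$, let $\rho=\frac12\sum_i\alpha_i$ and $$p_\lambda(\mu)=\tfrac12(\mu,\mu)-(\rho,\mu)-(\lambda,\mu)\qquad(\mu\in\mathfrak h^*).$$ For a word $w=(w_1,\dots,w_{|w|})$ with letters in $\{1,\dots,k\}$ put $w_{i\dots j}=(w_i,\dots,w_j)$ (empty if $j<i$), $\alpha_w=\sum_i\alpha_{w_i}$,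 $X_w=X_{w_1}\cdots X_{w_{|w|}}$, $Y_w=Y_{w_1}\cdots Y_{w_{|w|}}$ and $p^w_\lambda(\mu)=\prod_{i=0}^{|w|-1}p_\lambda(\mu-\alpha_{w_{1\dots i}})$. Let $\tilde W$ be the set of words $w$ with $\alpha_{w_{i\dots|w|}}\in\mathbb N_0\hat\Delta^+$ for all $i=1,\dots,|w|$. Grade $\mathfrak g$ by giving each simple root space $\mathfrak g^\alpha$ degree $1$ if $\alpha\in\hat\Delta$ and degree $0$ if $\alpha\in\Delta'$, and let $U(\tilde{\mathfrak n}^+)\hat\otimes U(\tilde{\mathfrak n}^-)$ be the completion of the tensor product with respect to the filtration by the subspaces $\bigoplus_{i+j\ge n}U_i(\tilde{\mathfrak n}^+)\otimes U_{-j}(\tilde{\mathfrak n}^-)$. The canonical element of a non-degenerate pairing is the element $\sum_iu_i\otimes v_i$ of this completion, where $\{u_i\}$, $\{v_i\}$ are dual bases of $U(\tilde{\mathfrak n}^+)$, $U(\tilde{\mathfrak n}^-)$. **Theorem.** Suppose that $\lambda\in\tilde\Omega$, i.e. $p_\lambda(\mu)\ne0$ for all $\mu\in\mathbb N_0\hat\Delta^+\setminus\{0\}$.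 Then $\langle\cdot,\cdot\rangle_{\sim,\lambda}$ is non-degenerate (in both arguments); dual bases exist, and for all of them $\sum_iu_i\otimes v_i$ converges to one and the same element $F_\lambda$ of the completion; the numbers $p^w_\lambda(\alpha_w)$ with $w\in\tilde W$ are non-zero; and $$F_\lambda=\sum_{w\in\tilde W}p^w_\lambda(\alpha_w)^{-1}\,\pi^+(X_w)\otimes\pi^-(Y_w)=\sum_{w\in\tilde W}\prod_{i=1}^{|w|}p_\lambda(\alpha_{w_{i\dots|w|}})^{-1}\,\pi^+(X_w)\otimes\pi^-(Y_w),$$ where both sums converge in the completion. -/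

import Mathlib

noncomputable section

namespace Shapovalov

open LieAlgebra LieAlgebra.IsKilling LieModule TensorProduct

attribute [local instance 100] LieRing.ofAssociativeRing

/-! ## Linear algebra -/

section Linear

variable {V W : Type*} [AddCommGroup V] [Module ℂ V] [AddCommGroup W] [Module ℂ W]

open Classical in
/-- The inverse of a bijective linear map (and `0` if the map is not bijective). -/
def linInv (f : V →ₗ[ℂ] W) : W →ₗ[ℂ] V :=
  if h : Function.Bijective f then ((LinearEquiv.ofBijective f h).symm : W →ₗ[ℂ] V) else 0

end Linear

/-! ## Enveloping algebras -/

section Enveloping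

variable (K : Type*) [LieRing K] [LieAlgebra ℂ K]

/-- The universal enveloping algebra of a complex Lie algebra. -/
abbrev U := UniversalEnvelopingAlgebra ℂ K

/-- The canonical map of a Lie algebra into its enveloping algebra. -/
abbrev iota : K →ₗ⁅ℂ⁆ U K := UniversalEnvelopingAlgebra.ι ℂ

/-- The Lie algebra morphism `X ↦ -X` into the opposite of the enveloping algebra. -/
def negOp : K →ₗ⁅ℂ⁆ (U K)ᵐᵒᵖ where
  toFun x := MulOpposite.op (-(iota K x))
  map_add' x y := by simp [add_comm]
  map_smul' c x := by simp
  map_lie' {x y} := by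
    apply MulOpposite.unop_injective
    simp only [LieHom.map_lie, LieRing.of_associative_ring_bracket, MulOpposite.unop_op,
      MulOpposite.unop_sub, MulOpposite.unop_mul]
    noncomm_ring

/-- The antipode of the enveloping algebra: the anti-automorphism with `S X = -X` for `X ∈ K`. -/
def antipode : U K →ₗ[ℂ] U K :=
  (MulOpposite.opLinearEquiv ℂ : U K ≃ₗ[ℂ] (U K)ᵐᵒᵖ).symm.toLinearMap ∘ₗ
    (UniversalEnvelopingAlgebra.lift ℂ (negOp K)).toLinearMap

end Enveloping

section Main

variable {L : Type*} [LieRing L] [LieAlgebra ℂ L]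

/-- The algebra morphism `U K → U L` induced by the inclusion of a Lie subalgebra `K ⊆ L`. -/
def incl (K : LieSubalgebra ℂ L) : U K →ₐ[ℂ] U L :=
  UniversalEnvelopingAlgebra.lift ℂ ((iota L).comp K.incl)

/-- The stabilizer `{X | ad_X^* lam = 0}` of a linear functional under the coadjoint action. -/
def stabilizer (lam : Module.Dual ℂ L) : Set L := {X | ∀ Y : L, lam ⁅X, Y⁆ = 0}

/-! ## Induced modules and the pairing between them

Below `P` and `Q` are opposite nilpotent subalgebras that are normalized by the stabilizer of the
functional `lam`, and `lam` is a character of this stabilizer. -/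

/-- The left ideal of `U L` generated by `X - lam X`, for `X` in the stabilizer of `lam`, and by
`X ∈ P`. -/
def leftIdeal (lam : Module.Dual ℂ L) (P : LieSubalgebra ℂ L) : Submodule (U L) (U L) :=
  Submodule.span (U L)
    ({a | ∃ X ∈ stabilizer lam, a = iota L X - algebraMap ℂ (U L) (lam X)} ∪
      {a | ∃ X ∈ P, a = iota L X})

/-- The right ideal of `U L` generated by `X - lam X`, for `X` in the stabilizer of `lam`, and by
`X ∈ P`. -/
def rightIdeal (lam : Module.Dual ℂ L) (P : LieSubalgebra ℂ L) :
    Submodule (U L)ᵐᵒᵖ (U L) :=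
  Submodule.span (U L)ᵐᵒᵖ
    ({a | ∃ X ∈ stabilizer lam, a = iota L X - algebraMap ℂ (U L) (lam X)} ∪
      {a | ∃ X ∈ P, a = iota L X})

/-- The generalized Verma module `U L ⊗_{U b} ℂ_lam`, where `b` is the sum of the stabilizer of
`lam` and `P`, which acts on `ℂ_lam` by `lam` on the stabilizer and by zero on `P`. It is presented
as the quotient of `U L` by the left ideal generated by the kernel of this character; the class of
`w` is `w ⊗ η`. -/
abbrev Verma (lam : Module.Dual ℂ L) (P : LieSubalgebra ℂ L) := U L ⧸ leftIdeal lam P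

/-- The right module `ℂ_lam ⊗_{U b} U L`, presented in the same way; the class of `w` is
`η* ⊗ w`. -/
abbrev RightVerma (lam : Module.Dual ℂ L) (P : LieSubalgebra ℂ L) := U L ⧸ rightIdeal lam P

/-- The map `w ↦ w ⊗ η` from `U L` to the generalized Verma module. -/
def vermaMk (lam : Module.Dual ℂ L) (P : LieSubalgebra ℂ L) : U L →ₗ[ℂ] Verma lam P :=
  (leftIdeal lam P).mkQ.restrictScalars ℂ

/-- The map `w ↦ η* ⊗ w` from `U L` to the right generalized Verma module. -/
def rightVermaMk (lam : Module.Dual ℂ L) (P : LieSubalgebra ℂ L) :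
    U L →ₗ[ℂ] RightVerma lam P :=
  (rightIdeal lam P).mkQ.restrictScalars ℂ

/-- The relations `(x ◁ w) ⊗ y = x ⊗ (w ▷ y)`. -/
def balancing (lam : Module.Dual ℂ L) (P Q : LieSubalgebra ℂ L) :
    Submodule ℂ (RightVerma lam Q ⊗[ℂ] Verma lam P) :=
  Submodule.span ℂ {t | ∃ (x : RightVerma lam Q) (w : U L) (y : Verma lam P),
    t = (MulOpposite.op w • x) ⊗ₜ[ℂ] y - x ⊗ₜ[ℂ] (w • y)}

/-- The tensor product over `U L` of the right and the left generalized Verma module. -/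
abbrev BalancedTensor (lam : Module.Dual ℂ L) (P Q : LieSubalgebra ℂ L) :=
  (RightVerma lam Q ⊗[ℂ] Verma lam P) ⧸ balancing lam P Q

/-- The isomorphism of the tensor product over `U L` with `ℂ` that sends `z η* ⊗ η` to `z`. -/
def toScalar (lam : Module.Dual ℂ L) (P Q : LieSubalgebra ℂ L) :
    BalancedTensor lam P Q →ₗ[ℂ] ℂ :=
  linInv (LinearMap.toSpanSingleton ℂ (BalancedTensor lam P Q)
    ((balancing lam P Q).mkQ (rightVermaMk lam Q 1 ⊗ₜ[ℂ] vermaMk lam P 1)))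

/-- The pairing `(x, y) ↦ x ⊗ y` between the right and the left generalized Verma module. -/
def vermaPairing (lam : Module.Dual ℂ L) (P Q : LieSubalgebra ℂ L) :
    RightVerma lam Q →ₗ[ℂ] Verma lam P →ₗ[ℂ] ℂ :=
  (TensorProduct.mk ℂ (RightVerma lam Q) (Verma lam P)).compr₂
    (toScalar lam P Q ∘ₗ (balancing lam P Q).mkQ)

/-- The pairing `(u, v) ↦ ⟨η* ⊗ S u, v ⊗ η⟩` between `U P` and `U Q`. -/
def pairing (lam : Module.Dual ℂ L) (P Q : LieSubalgebra ℂ L) :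
    U P →ₗ[ℂ] U Q →ₗ[ℂ] ℂ :=
  (vermaPairing lam P Q).compl₁₂
    (rightVermaMk lam Q ∘ₗ (incl P).toLinearMap ∘ₗ antipode P)
    (vermaMk lam P ∘ₗ (incl Q).toLinearMap)

/-! ## Roots and orderings -/

variable [FiniteDimensional ℂ L] [IsSemisimple ℂ L]

/-- The element of `L` dual to a linear functional with respect to the Killing form. -/
def sharp (lam : Module.Dual ℂ L) : L :=
  (LinearMap.BilinForm.toDual (killingForm ℂ L)
    (IsKilling.killingForm_nondegenerate ℂ L)).symm lam

variable (H : LieSubalgebra ℂ L) [H.IsCartanSubalgebra]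

/-- The bilinear form on the dual of the Cartan subalgebra induced by the Killing form. -/
def form (μ ν : Module.Dual ℂ H) : ℂ :=
  killingForm ℂ L ((cartanEquivDual H).symm μ : H) ((cartanEquivDual H).symm ν : H)

/-- The restriction of a linear functional to the Cartan subalgebra. -/
def restr (lam : Module.Dual ℂ L) : Module.Dual ℂ H := lam ∘ₗ H.toSubmodule.subtype

/-- An ordering of the root system, given by its set of positive roots, that is invariant with
respect to `lam`. The last field says: if `α` is positive with `(α, lam) ≠ 0` and `β` is a root with
`(β, lam) = 0` such that `α + β` is a root, then `α + β` is positive (the condition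
`(α + β, lam) ≠ 0` is then automatic). -/
structure InvariantOrdering (lam : Module.Dual ℂ L) where
  /-- The positive roots. -/
  pos : Finset (Weight ℂ H L)
  pos_subset : pos ⊆ H.root
  mem_or_neg_mem : ∀ α ∈ H.root, α ∈ pos ∨ -α ∈ pos
  neg_notMem : ∀ α ∈ pos, -α ∉ pos
  add_mem : ∀ α ∈ pos, ∀ β ∈ pos, ∀ γ ∈ H.root,
    γ.toLinear = α.toLinear + β.toLinear → γ ∈ pos
  invariant : ∀ α ∈ pos, form H α.toLinear (restr H lam) ≠ 0 →
    ∀ β ∈ H.root, form H β.toLinear (restr H lam) = 0 →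
    ∀ γ ∈ H.root, γ.toLinear = α.toLinear + β.toLinear → γ ∈ pos

variable {H}

/-- The sum of the root spaces of a set `s` of weights that is closed under addition as far as the
sums are weights, as a Lie subalgebra. -/
def rootSubalgebra (s : Set (Weight ℂ H L))
    (hs : ∀ α ∈ s, ∀ β ∈ s, ∀ γ : Weight ℂ H L,
      γ.toLinear = α.toLinear + β.toLinear → γ ∈ s) : LieSubalgebra ℂ L where
  toSubmodule := ⨆ α ∈ s, (rootSpace H α).toSubmodule
  lie_mem' {x y} hx hy := by
    have key : ∀ α ∈ s, ∀ β ∈ s, ∀ a ∈ rootSpace H α, ∀ b ∈ rootSpace H β,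
        ⁅a, b⁆ ∈ ⨆ α ∈ s, (rootSpace H α).toSubmodule := by
      intro α hα β hβ a ha b hb
      have hab := lie_mem_genWeightSpace_of_mem_genWeightSpace ha hb
      by_cases h : genWeightSpace L ((α : H → ℂ) + (β : H → ℂ)) = ⊥
      · rw [h, LieSubmodule.mem_bot] at hab
        rw [hab]
        exact Submodule.zero_mem _
      · exact Submodule.mem_iSup_of_mem (⟨(α : H → ℂ) + (β : H → ℂ), h⟩ : Weight ℂ H L)
          (Submodule.mem_iSup_of_mem (hs α hα β hβ _ (by ext; rfl)) hab)
    change x ∈ ⨆ α ∈ s, (rootSpace H α).toSubmodule at hx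
    change y ∈ ⨆ α ∈ s, (rootSpace H α).toSubmodule at hy
    change ⁅x, y⁆ ∈ ⨆ α ∈ s, (rootSpace H α).toSubmodule
    have hx' : x ∈ ((⨆ α ∈ s, (rootSpace H α).toSubmodule).comap
        ((LieModule.toEnd ℂ L L : L →ₗ[ℂ] Module.End ℂ L).flip y)) := by
      refine (iSup₂_le fun α hα a ha => ?_ :
        (⨆ α ∈ s, (rootSpace H α).toSubmodule) ≤ _) hx
      change ⁅a, y⁆ ∈ ⨆ α ∈ s, (rootSpace H α).toSubmodule
      have : y ∈ ((⨆ α ∈ s, (rootSpace H α).toSubmodule).comap (LieModule.toEnd ℂ L L a)) := by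
        refine (iSup₂_le fun β hβ b hb => ?_ :
          (⨆ α ∈ s, (rootSpace H α).toSubmodule) ≤ _) hy
        exact key α hα β hβ a ha b hb
      exact this
    exact hx'

lemma rootSpace_le_rootSubalgebra {s : Set (Weight ℂ H L)}
    {hs : ∀ α ∈ s, ∀ β ∈ s, ∀ γ : Weight ℂ H L,
      γ.toLinear = α.toLinear + β.toLinear → γ ∈ s}
    {α : Weight ℂ H L} (hα : α ∈ s) {x : L} (hx : x ∈ rootSpace H α) :
    x ∈ rootSubalgebra s hs :=
  (Submodule.mem_iSup_of_mem α (Submodule.mem_iSup_of_mem hα hx) :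
    x ∈ ⨆ α ∈ s, (rootSpace H α).toSubmodule)

namespace InvariantOrdering

variable {lam : Module.Dual ℂ L} (O : InvariantOrdering H lam)

/-- The positive roots `α` with `(α, lam) ≠ 0`. -/
def hatPos : Set (Weight ℂ H L) := {α | α ∈ O.pos ∧ form H α.toLinear (restr H lam) ≠ 0}


lemma pos_closed : ∀ α ∈ (O.pos : Set (Weight ℂ H L)), ∀ β ∈ (O.pos : Set (Weight ℂ H L)),
    ∀ γ : Weight ℂ H L, γ.toLinear = α.toLinear + β.toLinear →
      γ ∈ (O.pos : Set (Weight ℂ H L)) := by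
  intro α hα β hβ γ h
  refine O.add_mem α hα β hβ γ ?_ h
  suffices γ.IsNonZero by simpa using this
  intro h0
  have h1 : γ.toLinear = 0 := by simpa using h0
  rw [h1] at h
  apply O.neg_notMem α hα
  have : -α = β := by
    ext x
    have := LinearMap.congr_fun h x
    simp only [LinearMap.zero_apply, LinearMap.add_apply, Weight.toLinear_apply] at this
    simp only [Weight.coe_neg, Pi.neg_apply]
    linear_combination this
  rw [this]
  exact hβ

lemma hatPos_closed : ∀ α ∈ O.hatPos, ∀ β ∈ O.hatPos, ∀ γ : Weight ℂ H L,
    γ.toLinear = α.toLinear + β.toLinear → γ ∈ O.hatPos := by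
  intro α hα β hβ γ h
  have hγ : γ ∈ O.pos := O.pos_closed α hα.1 β hβ.1 γ h
  refine ⟨hγ, fun h0 => O.neg_notMem β hβ.1 ?_⟩
  have hroot : ∀ δ ∈ O.pos, -δ ∈ H.root := by
    intro δ hδ
    have := O.pos_subset hδ
    simpa using this
  refine O.invariant α hα.1 hα.2 (-γ) (hroot γ hγ) ?_ (-β) (hroot β hβ.1) ?_
  · simpa [form] using h0
  · rw [Weight.toLinear_neg, Weight.toLinear_neg, h]
    abel

lemma neg_closed {s : Set (Weight ℂ H L)} (hs : ∀ α ∈ s, ∀ β ∈ s, ∀ γ : Weight ℂ H L,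
    γ.toLinear = α.toLinear + β.toLinear → γ ∈ s) :
    ∀ α ∈ {α : Weight ℂ H L | -α ∈ s}, ∀ β ∈ {α : Weight ℂ H L | -α ∈ s},
      ∀ γ : Weight ℂ H L, γ.toLinear = α.toLinear + β.toLinear →
        γ ∈ {α : Weight ℂ H L | -α ∈ s} := by
  intro α hα β hβ γ h
  refine hs (-α) hα (-β) hβ (-γ) ?_
  rw [Weight.toLinear_neg, Weight.toLinear_neg, Weight.toLinear_neg, h]
  abel

/-- `n⁺`, the sum of the root spaces of the positive roots. -/
def nPos : LieSubalgebra ℂ L := rootSubalgebra (O.pos : Set (Weight ℂ H L)) O.pos_closed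

/-- `n⁻`, the sum of the root spaces of the negative roots. -/
def nNeg : LieSubalgebra ℂ L :=
  rootSubalgebra {α | -α ∈ (O.pos : Set (Weight ℂ H L))} (neg_closed O.pos_closed)

lemma mem_nPos {α : Weight ℂ H L} (hα : α ∈ O.pos) {x : L} (hx : x ∈ rootSpace H α) :
    x ∈ O.nPos :=
  rootSpace_le_rootSubalgebra (Finset.mem_coe.mpr hα) hx

lemma mem_nNeg {α : Weight ℂ H L} (hα : α ∈ O.pos) {x : L}
    (hx : x ∈ rootSpace H (-α : Weight ℂ H L)) : x ∈ O.nNeg := by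
  have h : (-α : Weight ℂ H L) ∈ {β : Weight ℂ H L | -β ∈ (O.pos : Set (Weight ℂ H L))} := by
    simpa using hα
  exact rootSpace_le_rootSubalgebra h hx

/-- `ñ⁺`, the sum of the root spaces of the positive roots `α` with `(α, lam) ≠ 0`. -/
def nHatPos : LieSubalgebra ℂ L := rootSubalgebra O.hatPos O.hatPos_closed

/-- `ñ⁻`, the sum of the root spaces of the negative roots `α` with `(α, lam) ≠ 0`. -/
def nHatNeg : LieSubalgebra ℂ L :=
  rootSubalgebra {α | -α ∈ O.hatPos} (neg_closed O.hatPos_closed)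

/-- The generalized Shapovalov pairing between `U ñ⁺` and `U ñ⁻`. -/
def shapovalov : U O.nHatPos →ₗ[ℂ] U O.nHatNeg →ₗ[ℂ] ℂ := pairing lam O.nHatPos O.nHatNeg

/-- The projection `π⁺` from `U n⁺` to `U ñ⁺`: it sends `u` to `S u'`, where `u'` is determined by
`η* ⊗ u' = η* ⊗ S u` in the right generalized Verma module. -/
def projPos : U O.nPos →ₗ[ℂ] U O.nHatPos :=
  antipode O.nHatPos ∘ₗ
    linInv (rightVermaMk lam O.nHatNeg ∘ₗ (incl O.nHatPos).toLinearMap) ∘ₗ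
    rightVermaMk lam O.nHatNeg ∘ₗ (incl O.nPos).toLinearMap ∘ₗ antipode O.nPos

/-- The projection `π⁻` from `U n⁻` to `U ñ⁻`: it sends `v` to the element `v'` determined by
`v' ⊗ η = v ⊗ η` in the generalized Verma module. -/
def projNeg : U O.nNeg →ₗ[ℂ] U O.nHatNeg :=
  linInv (vermaMk lam O.nHatPos ∘ₗ (incl O.nHatNeg).toLinearMap) ∘ₗ
    vermaMk lam O.nHatPos ∘ₗ (incl O.nNeg).toLinearMap

/-! ## The number `p_lam`, words, and the set `Ω̃` -/

/-- Half the sum of the positive roots. -/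
def rho : Module.Dual ℂ H := (1 / 2 : ℂ) • ∑ α ∈ O.pos, α.toLinear

/-- `p_lam(μ) = (μ, μ) / 2 - (ρ, μ) - (lam, μ)`. -/
def p (μ : Module.Dual ℂ H) : ℂ :=
  1 / 2 * form H μ μ - form H O.rho μ - form H (restr H lam) μ

/-- The set of linear combinations, with coefficients in `ℕ`, of the positive roots `α` with
`(α, lam) ≠ 0`. -/
def hatCone : AddSubmonoid (Module.Dual ℂ H) :=
  AddSubmonoid.closure {μ | ∃ α ∈ O.hatPos, μ = α.toLinear}

/-- The condition `lam ∈ Ω̃`. -/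
def MemOmegaTilde : Prop := ∀ μ ∈ O.hatCone, μ ≠ 0 → O.p μ ≠ 0

/-- Words, with the positive roots as letters. -/
abbrev Word := List {α // α ∈ O.pos}

/-- The weight `α_w` of a word: the sum of its letters. -/
def wt (w : O.Word) : Module.Dual ℂ H := (w.map fun a => a.1.toLinear).sum

/-- The set `W̃` of words all of whose non-empty suffixes `w_i … w_|w|` have a weight that is an
`ℕ`-linear combination of positive roots `α` with `(α, lam) ≠ 0`. -/
def wordsTilde : Set O.Word := {w | ∀ i < w.length, O.wt (w.drop i) ∈ O.hatCone}

/-- `p_lam^w(μ) = ∏_{i = 0}^{|w| - 1} p_lam(μ - α_{w_1 … w_i})`. -/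
def pWord (w : O.Word) (μ : Module.Dual ℂ H) : ℂ :=
  ∏ i ∈ Finset.range w.length, O.p (μ - O.wt (w.take i))

/-- A choice of `X_α ∈ g^α` and `Y_α ∈ g^{-α}` with `B(X_α, Y_α) = 1` for each positive root `α`,
where `B` is the Killing form. -/
structure RootVectors where
  X : {α // α ∈ O.pos} → L
  Y : {α // α ∈ O.pos} → L
  X_mem : ∀ a, X a ∈ rootSpace H a.1
  Y_mem : ∀ a, Y a ∈ rootSpace H (-a.1 : Weight ℂ H L)
  killing : ∀ a, killingForm ℂ L (X a) (Y a) = 1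

variable {O}

/-- `X_w ∈ U n⁺`, the product of the `X_α` over the letters of the word `w`. -/
def RootVectors.wordX (R : O.RootVectors) (w : O.Word) : U O.nPos :=
  (w.map fun a => iota O.nPos ⟨R.X a, O.mem_nPos a.2 (R.X_mem a)⟩).prod

/-- `Y_w ∈ U n⁻`, the product of the `Y_α` over the letters of the word `w`. -/
def RootVectors.wordY (R : O.RootVectors) (w : O.Word) : U O.nNeg :=
  (w.map fun a => iota O.nNeg ⟨R.Y a, O.mem_nNeg a.2 (R.Y_mem a)⟩).prod

variable (O)

/-! ## The completed tensor product and canonical elements -/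

open Classical in
/-- The simple roots: the positive roots that are not a sum of two positive roots. -/
def simple : Finset (Weight ℂ H L) :=
  {α ∈ O.pos | ¬ ∃ β ∈ O.pos, ∃ γ ∈ O.pos, α.toLinear = β.toLinear + γ.toLinear}

open Classical in
/-- The weight `μ` has degree `n` if `μ = ∑ c_β β` is an integral linear combination of simple roots
such that `n` is the sum of the `c_β` over the simple roots `β` with `(β, lam) ≠ 0`. -/
def HasDegree (μ : Module.Dual ℂ H) (n : ℤ) : Prop :=
  ∃ c : Weight ℂ H L → ℤ, μ = ∑ β ∈ O.simple, c β • β.toLinear ∧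
    n = ∑ β ∈ O.simple with β ∈ O.hatPos, c β

/-- The part of degree `n` of `U K`: the span of the products of root vectors in `K` for which the
sum of the roots has degree `n`. -/
def gradedPiece (K : LieSubalgebra ℂ L) (n : ℤ) : Submodule ℂ (U K) :=
  Submodule.span ℂ {a | ∃ l : List (Weight ℂ H L × K),
    (∀ b ∈ l, (b.2 : L) ∈ rootSpace H b.1) ∧
    O.HasDegree (l.map fun b => b.1.toLinear).sum n ∧
    a = (l.map fun b => iota K b.2).prod}

/-- The part of `U ñ⁺ ⊗ U ñ⁻` spanned by the tensor products of an element of degree `i` and an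
element of degree `-j` with `i + j ≥ n`. -/
def filtration (n : ℕ) : Submodule ℂ (U O.nHatPos ⊗[ℂ] U O.nHatNeg) :=
  Submodule.span ℂ {t | ∃ i j : ℕ, n ≤ i + j ∧ ∃ a ∈ O.gradedPiece O.nHatPos (i : ℤ),
    ∃ b ∈ O.gradedPiece O.nHatNeg (-(j : ℤ)), t = a ⊗ₜ[ℂ] b}

lemma filtration_antitone {m n : ℕ} (h : m ≤ n) : O.filtration n ≤ O.filtration m := by
  apply Submodule.span_mono
  rintro t ⟨i, j, hij, ht⟩
  exact ⟨i, j, h.trans hij, ht⟩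

/-- The completion of `U ñ⁺ ⊗ U ñ⁻` with respect to the grading: the inverse limit of its quotients
by the parts of degree at least `n`. -/
def CompletedTensor : Submodule ℂ
    (∀ n : ℕ, (U O.nHatPos ⊗[ℂ] U O.nHatNeg) ⧸ O.filtration n) where
  carrier := {x | ∀ m n : ℕ, ∀ h : m ≤ n,
    Submodule.factor (O.filtration_antitone h) (x n) = x m}
  add_mem' {x y} hx hy m n h := by simp [hx m n h, hy m n h]
  zero_mem' m n h := by simp
  smul_mem' c x hx m n h := by simp [hx m n h]

/-- The family `t` is summable in the completed tensor product, with sum `F`: modulo the part of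
degree at least `n`, all but finitely many of its members vanish and the others add up to `F`. -/
def HasFormalSum {I : Type*} (t : I → U O.nHatPos ⊗[ℂ] U O.nHatNeg) (F : O.CompletedTensor) :
    Prop :=
  ∀ n : ℕ, ∃ s : Finset I, (∀ i ∉ s, t i ∈ O.filtration n) ∧
    ∑ i ∈ s, (O.filtration n).mkQ (t i) = F.1 n

/-- Bases `u` of `U ñ⁺` and `v` of `U ñ⁻` that are dual to each other with respect to the generalized
Shapovalov pairing. -/
def AreDual {I : Type*} (u : Module.Basis I ℂ (U O.nHatPos))
    (v : Module.Basis I ℂ (U O.nHatNeg)) : Prop :=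
  (∀ i, O.shapovalov (u i) (v i) = 1) ∧ ∀ i j, i ≠ j → O.shapovalov (u i) (v j) = 0

/-- `F` is the canonical element of the generalized Shapovalov pairing: there are dual bases `u`,
`v`, and the sum of `u i ⊗ v i` is `F` for every choice of dual bases. -/
def IsCanonicalElement (F : O.CompletedTensor) : Prop :=
  (∃ (I : Type) (u : Module.Basis I ℂ (U O.nHatPos)) (v : Module.Basis I ℂ (U O.nHatNeg)),
    O.AreDual u v) ∧
  ∀ (I : Type) (u : Module.Basis I ℂ (U O.nHatPos)) (v : Module.Basis I ℂ (U O.nHatNeg)),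
    O.AreDual u v → O.HasFormalSum (fun i => u i ⊗ₜ[ℂ] v i) F

end InvariantOrdering

end Main

end Shapovalov

end

/-!
The pairing is an expectation value. The algebra `L` is the direct sum of `ñ⁻`, the stabilizer of
`lam` and `ñ⁺`, where both nilpotent subalgebras are normalized by the stabilizer. Hence `L` acts on
`U ñ⁻`: elements of `ñ⁻` act by left multiplication, elements of `ñ⁺` annihilate the vector `1`, and
the stabilizer acts on it by `lam`. This action is constructed directly (`Triangular.act`); it shows
that `U ñ⁻` is the generalized Verma module (`Triangular.bijective_vermaMk`) without the
Poincaré–Birkhoff–Witt theorem. The antipode, which exchanges left and right ideals and `lam` and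
`-lam`, gives the corresponding statement for right modules. Consequently `⟨u, v⟩` is the counit of
`S(u) v`, where `S(u)` acts on `v ∈ U ñ⁻` (`shapovalov_eq`).

The action of the Casimir element of `L` by a scalar says that
`∑ Y_α X_α v = -p_lam(μ) v` for vectors `v` of weight `lam - μ` (`RootVectors.sum_act`). The weights
that occur satisfy `μ ∈ ℕ₀ Δ̂⁺`, and `p_lam(μ) ≠ 0` unless `μ = 0`, so `v = -p_lam(μ)⁻¹ ∑ Y_α X_α v`.
The vectors `X_α v` have smaller weights or vanish. Iteration leads down to multiples of `1`, and
gives the expansion `v = ∑_w c_w ⟨π⁺ X_w, v⟩ π⁻ Y_w` over the words `w ∈ W̃`, where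
`c_w = ∏ p_lam(α_{w_i … w_|w|})⁻¹` (`expansion_of_mem_wtPiece`, `expansion`). The sum over the words
of a given weight is finite because a non-empty sum of positive roots never vanishes
(`sum_ne_zero`, `finite_wt_eq`).

The expansion shows that the pairing separates the points of `U ñ⁻`. Exchanging the roles of positive
and negative roots, and `lam` and `-lam`, flips the pairing and preserves all the hypotheses, so it
also separates the points of `U ñ⁺`. The weight spaces of `U ñ⁻` are finite-dimensional and the
pairing is orthogonal with respect to weights; hence there are dual bases (`exists_dual_bases`).
Finally, if `u_i` and `v_i` are dual bases, then inserting the expansion of `v_i` into `∑ u_i ⊗ v_i`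
and using `∑ ⟨x, v_i⟩ u_i = x` turns this sum into `∑_w c_w π⁺ X_w ⊗ π⁻ Y_w`
(`AreDual.hasFormalSum`). In every degree only finitely many words contribute
(`exists_finset_words`).
-/

noncomputable section

namespace Shapovalov

open LieAlgebra LieAlgebra.IsKilling LieModule TensorProduct

attribute [local instance 100] LieRing.ofAssociativeRing

set_option linter.unusedSectionVars false

/-! ### Enveloping algebras and the antipode -/

section Enveloping

variable {K : Type*} [LieRing K] [LieAlgebra ℂ K]

lemma iota_lie (x y : K) : iota K ⁅x, y⁆ = iota K x * iota K y - iota K y * iota K x := by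
  rw [LieHom.map_lie, LieRing.of_associative_ring_bracket]

/-- Enveloping algebras are spanned by products of elements of the Lie algebra. -/
lemma U_induction (N : Submodule ℂ (U K)) (h1 : (1 : U K) ∈ N)
    (hmul : ∀ x : K, ∀ a ∈ N, iota K x * a ∈ N) : ∀ a, a ∈ N := by
  -- the elements whose left multiplication preserves `N` form a subalgebra containing `K`
  let S : Subalgebra ℂ (U K) :=
    { carrier := {b | ∀ a ∈ N, b * a ∈ N}
      mul_mem' := fun {b c} hb hc a ha => by rw [mul_assoc]; exact hb _ (hc _ ha)
      add_mem' := fun {b c} hb hc a ha => by rw [add_mul]; exact N.add_mem (hb _ ha) (hc _ ha)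
      algebraMap_mem' := fun r a ha => by
        rw [← Algebra.smul_def]; exact N.smul_mem _ ha }
  let f : K →ₗ⁅ℂ⁆ S :=
    { toFun := fun x => ⟨iota K x, hmul x⟩
      map_add' := fun x y => by ext; simp
      map_smul' := fun c x => by ext; simp
      map_lie' := fun {x y} => by
        apply Subtype.ext
        rw [LieRing.of_associative_ring_bracket]
        exact iota_lie x y }
  have hF : S.val.comp (UniversalEnvelopingAlgebra.lift ℂ f) = AlgHom.id ℂ (U K) := by
    apply UniversalEnvelopingAlgebra.hom_ext
    ext x
    change ((UniversalEnvelopingAlgebra.lift ℂ f (iota K x) : S) : U K) = iota K x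
    rw [UniversalEnvelopingAlgebra.lift_ι_apply]
    rfl
  intro a
  have : a ∈ S := by
    have h := congrArg (fun g : U K →ₐ[ℂ] U K => g a) hF
    rw [← show ((UniversalEnvelopingAlgebra.lift ℂ f a : S) : U K) = a from h]
    exact Subtype.property _
  simpa using this 1 h1

@[simp] lemma antipode_iota (x : K) : antipode K (iota K x) = -iota K x := by
  change MulOpposite.unop (UniversalEnvelopingAlgebra.lift ℂ (negOp K) (iota K x)) = _
  rw [UniversalEnvelopingAlgebra.lift_ι_apply]
  rfl

@[simp] lemma antipode_one : antipode K 1 = 1 := by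
  change MulOpposite.unop (UniversalEnvelopingAlgebra.lift ℂ (negOp K) 1) = _
  rw [map_one]
  rfl

@[simp] lemma antipode_mul (a b : U K) : antipode K (a * b) = antipode K b * antipode K a := by
  change MulOpposite.unop (UniversalEnvelopingAlgebra.lift ℂ (negOp K) (a * b)) = _
  rw [map_mul]
  rfl

@[simp] lemma antipode_antipode (a : U K) : antipode K (antipode K a) = a := by
  refine U_induction (LinearMap.eqLocus (antipode K ∘ₗ antipode K) LinearMap.id) ?_ ?_ a
  · simp
  · intro x a ha
    have ha : antipode K (antipode K a) = a := ha
    simp [-UniversalEnvelopingAlgebra.ι_apply, ha]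

lemma antipode_algebraMap (c : ℂ) : antipode K (algebraMap ℂ (U K) c) = algebraMap ℂ (U K) c := by
  rw [Algebra.algebraMap_eq_smul_one, map_smul, antipode_one]

/-- The counit of the enveloping algebra. -/
def counit (K : Type*) [LieRing K] [LieAlgebra ℂ K] : U K →ₐ[ℂ] ℂ :=
  UniversalEnvelopingAlgebra.lift ℂ (0 : K →ₗ⁅ℂ⁆ ℂ)

@[simp] lemma counit_iota (x : K) : counit K (iota K x) = 0 := by
  rw [counit, UniversalEnvelopingAlgebra.lift_ι_apply]
  rfl

@[simp] lemma incl_iota (Q : LieSubalgebra ℂ K) (x : Q) : incl Q (iota Q x) = iota K (x : K) := by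
  rw [incl, UniversalEnvelopingAlgebra.lift_ι_apply]
  rfl

lemma incl_antipode (Q : LieSubalgebra ℂ K) (a : U Q) :
    incl Q (antipode Q a) = antipode K (incl Q a) := by
  refine U_induction (LinearMap.eqLocus ((incl Q).toLinearMap ∘ₗ antipode Q)
    (antipode K ∘ₗ (incl Q).toLinearMap)) ?_ ?_ a
  · simp
  · intro x a ha
    have ha : incl Q (antipode Q a) = antipode K (incl Q a) := ha
    simp [-UniversalEnvelopingAlgebra.ι_apply, ha]

end Enveloping

/-! ### The action on the enveloping algebra of an opposite subalgebra -/

section Induced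

variable {L : Type*} [LieRing L] [LieAlgebra ℂ L]

/-- The stabilizer of a functional, as a linear subspace. -/
def stabSub (lam : Module.Dual ℂ L) : Submodule ℂ L where
  carrier := stabilizer lam
  add_mem' {x y} hx hy z := by rw [add_lie, map_add, hx z, hy z, add_zero]
  zero_mem' z := by simp
  smul_mem' c x hx z := by rw [smul_lie, map_smul, hx z, smul_zero]

@[simp] lemma mem_stabSub {lam : Module.Dual ℂ L} {x : L} :
    x ∈ stabSub lam ↔ ∀ y, lam ⁅x, y⁆ = 0 := Iff.rfl

lemma lie_mem_stabSub {lam : Module.Dual ℂ L} {x y : L} (hx : x ∈ stabSub lam)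
    (hy : y ∈ stabSub lam) : ⁅x, y⁆ ∈ stabSub lam := by
  intro z
  rw [lie_lie, map_sub, hx, hy, sub_zero]

/-- The algebra `L` is the direct sum of `Q`, the stabilizer of `lam` and `P`, where `P` and `Q` are
normalized by the stabilizer and annihilated by `lam`. -/
structure Triangular (lam : Module.Dual ℂ L) (P Q : LieSubalgebra ℂ L) : Prop where
  lam_P : ∀ x ∈ P, lam x = 0
  lam_Q : ∀ x ∈ Q, lam x = 0
  lie_P : ∀ z ∈ stabSub lam, ∀ x ∈ P, ⁅z, x⁆ ∈ P
  lie_Q : ∀ z ∈ stabSub lam, ∀ x ∈ Q, ⁅z, x⁆ ∈ Q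
  codisjoint : Q.toSubmodule ⊔ (stabSub lam ⊔ P.toSubmodule) = ⊤
  disjoint : Disjoint Q.toSubmodule (stabSub lam ⊔ P.toSubmodule)
  disjoint' : Disjoint P.toSubmodule (stabSub lam ⊔ Q.toSubmodule)

variable {lam : Module.Dual ℂ L} {P Q : LieSubalgebra ℂ L}

namespace Triangular

variable (T : Triangular lam P Q)

include T

/-- The projection to `Q` along the sum of the stabilizer and `P`. -/
def proj (T : Triangular lam P Q) : L →ₗ[ℂ] Q :=
  Submodule.projectionOnto Q.toSubmodule (stabSub lam ⊔ P.toSubmodule)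
    ⟨T.disjoint, codisjoint_iff.mpr T.codisjoint⟩

lemma proj_of_mem (x : Q) : T.proj x = x :=
  Submodule.projectionOnto_apply_left _ _

lemma proj_eq_zero {x : L} (hx : x ∈ stabSub lam ⊔ P.toSubmodule) : T.proj x = 0 :=
  (Submodule.projectionOnto_apply_eq_zero_iff _).mpr hx

lemma lie_mem {x y : L} (hx : x ∈ stabSub lam ⊔ P.toSubmodule)
    (hy : y ∈ stabSub lam ⊔ P.toSubmodule) :
    ⁅x, y⁆ ∈ stabSub lam ⊔ P.toSubmodule ∧ lam ⁅x, y⁆ = 0 := by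
  obtain ⟨z, hz, p, hp, rfl⟩ := Submodule.mem_sup.mp hx
  obtain ⟨z', hz', p', hp', rfl⟩ := Submodule.mem_sup.mp hy
  have h1 : ⁅z, p'⁆ ∈ P := T.lie_P z hz p' hp'
  have h2 : ⁅p, z'⁆ ∈ P := by
    rw [← lie_skew]; exact P.neg_mem (T.lie_P z' hz' p hp)
  have h3 : ⁅p, p'⁆ ∈ P := P.lie_mem hp hp'
  simp only [add_lie, lie_add]
  constructor
  · have hP : P.toSubmodule ≤ stabSub lam ⊔ P.toSubmodule := le_sup_right
    exact add_mem (add_mem (le_sup_left (a := stabSub lam) (lie_mem_stabSub hz hz')) (hP h2))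
      (add_mem (hP h1) (hP h3))
  · have e1 : lam ⁅z, z'⁆ = 0 := hz z'
    have e2 : lam ⁅z, p'⁆ = 0 := hz p'
    rw [map_add, map_add, map_add, e1, e2, T.lam_P _ h2, T.lam_P _ h3]
    simp

omit T in
variable (Q) in
/-- The natural action of `Q` on the space of linear maps from `L` to `U Q`. -/
def homAction : Q →ₗ⁅ℂ⁆ Module.End ℂ (L →ₗ[ℂ] U Q) where
  toFun Y :=
    { toFun := fun φ => LinearMap.mulLeft ℂ (iota Q Y) ∘ₗ φ - φ ∘ₗ LieModule.toEnd ℂ L L (Y : L)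
      map_add' := fun φ ψ => by ext x; simp [mul_add]; abel
      map_smul' := fun c φ => by ext x; simp [smul_sub] }
  map_add' Y Z := by
    refine LinearMap.ext fun φ => LinearMap.ext fun x => ?_
    simp [-UniversalEnvelopingAlgebra.ι_apply, add_mul]; abel
  map_smul' c Y := by
    refine LinearMap.ext fun φ => LinearMap.ext fun x => ?_
    simp [-UniversalEnvelopingAlgebra.ι_apply, smul_sub]
  map_lie' {Y Z} := by
    refine LinearMap.ext fun φ => LinearMap.ext fun x => ?_
    simp [-UniversalEnvelopingAlgebra.ι_apply, -LieHom.map_lie, iota_lie,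
      LieRing.of_associative_ring_bracket]
    noncomm_ring

omit T in
lemma homAction_apply (Y : Q) (φ : L →ₗ[ℂ] U Q) (x : L) :
    homAction Q Y φ x = iota Q Y * φ x + φ ⁅x, (Y : L)⁆ := by
  rw [← lie_skew, map_neg]
  simp [homAction, sub_eq_add_neg]

/-- The values of the action of `L` on the generator `1` of `U Q`: the sum of the projection to `Q` and
`lam`, which is correct on the stabilizer and on `P`, too, because `lam` vanishes on `P` and `Q`. -/
def actOne (T : Triangular lam P Q) : L →ₗ[ℂ] U Q :=
  (iota Q : Q →ₗ[ℂ] U Q) ∘ₗ T.proj + (Algebra.linearMap ℂ (U Q)) ∘ₗ lam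

/-- The action of `L` on `U Q`, as a map that sends `u` to `x ↦ x u`. It is determined by its value at
`u = 1` and the rule `x (Y u) = Y (x u) + [x, Y] u` for `Y ∈ Q`; this rule says that the map commutes
with `Q`, and it is well defined because `homAction` is a representation of `Q`. -/
def actMap (T : Triangular lam P Q) : U Q →ₗ[ℂ] (L →ₗ[ℂ] U Q) :=
  (LinearMap.applyₗ T.actOne) ∘ₗ (UniversalEnvelopingAlgebra.lift ℂ (homAction Q)).toLinearMap

lemma actMap_one (x : L) :
    T.actMap 1 x = iota Q (T.proj x) + algebraMap ℂ (U Q) (lam x) := by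
  simp only [actMap, actOne, LinearMap.comp_apply, AlgHom.toLinearMap_apply, map_one]
  rfl

lemma actMap_mul (Y : Q) (u : U Q) (x : L) :
    T.actMap (iota Q Y * u) x = iota Q Y * T.actMap u x + T.actMap u ⁅x, (Y : L)⁆ := by
  simp only [actMap, LinearMap.comp_apply, AlgHom.toLinearMap_apply, map_mul,
    UniversalEnvelopingAlgebra.lift_ι_apply]
  exact homAction_apply Y _ x

lemma actMap_mem (Z : Q) (u : U Q) : T.actMap u (Z : L) = iota Q Z * u := by
  have := U_induction (LinearMap.ker (LinearMap.pi fun Z : Q =>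
    (LinearMap.applyₗ (Z : L) ∘ₗ T.actMap - LinearMap.mulLeft ℂ (iota Q Z)))) ?_ ?_ u
  · rw [LinearMap.mem_ker] at this
    exact sub_eq_zero.mp (congrFun this Z)
  · refine funext fun Z => sub_eq_zero.mpr ?_
    change T.actMap 1 (Z : L) = iota Q Z * 1
    rw [actMap_one, T.lam_Q _ Z.2, T.proj_of_mem, map_zero, add_zero, mul_one]
  · intro Y a ha
    have ha : ∀ Z : Q, T.actMap a (Z : L) = iota Q Z * a :=
      fun Z => sub_eq_zero.mp (congrFun ha Z)
    refine funext fun Z => sub_eq_zero.mpr ?_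
    change T.actMap (iota Q Y * a) (Z : L) = iota Q Z * (iota Q Y * a)
    rw [actMap_mul, ha, ← LieSubalgebra.coe_bracket, ha, iota_lie]
    noncomm_ring

/-- The defect of the action identity vanishes on the generator, and by the Jacobi identity its value
on `Y u` is a combination of its values on `u`. -/
lemma actMap_lie (x y : L) (u : U Q) :
    T.actMap u ⁅x, y⁆ = T.actMap (T.actMap u y) x - T.actMap (T.actMap u x) y := by
  -- the identity for a pair with second member in `Q`
  have hQ : ∀ (x : L) (Y : Q) (u : U Q), T.actMap u ⁅x, (Y : L)⁆ =
      T.actMap (T.actMap u (Y : L)) x - T.actMap (T.actMap u x) (Y : L) := by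
    intro x Y u
    rw [actMap_mem, actMap_mem, actMap_mul]
    abel
  let D : L → L → (U Q →ₗ[ℂ] U Q) := fun x y =>
    LinearMap.applyₗ ⁅x, y⁆ ∘ₗ T.actMap
      - LinearMap.applyₗ x ∘ₗ T.actMap ∘ₗ LinearMap.applyₗ y ∘ₗ T.actMap
      + LinearMap.applyₗ y ∘ₗ T.actMap ∘ₗ LinearMap.applyₗ x ∘ₗ T.actMap
  have hD : ∀ x y u, D x y u =
      T.actMap u ⁅x, y⁆ - T.actMap (T.actMap u y) x + T.actMap (T.actMap u x) y :=
    fun x y u => rfl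
  suffices h : ∀ x y, D x y u = 0 by
    have := h x y
    rw [hD] at this
    rw [← sub_eq_zero, ← this]
    abel
  refine (LinearMap.mem_ker.trans (funext_iff.trans (forall_congr' fun x => funext_iff))).mp
    (U_induction (LinearMap.ker (LinearMap.pi fun x => LinearMap.pi fun y => D x y)) ?_ ?_ u)
  · refine funext fun x => funext fun y => ?_
    change D x y 1 = 0
    have hx : x ∈ Q.toSubmodule ⊔ (stabSub lam ⊔ P.toSubmodule) := by
      rw [T.codisjoint]; trivial
    have hy : y ∈ Q.toSubmodule ⊔ (stabSub lam ⊔ P.toSubmodule) := by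
      rw [T.codisjoint]; trivial
    obtain ⟨a, ha, b, hb, rfl⟩ := Submodule.mem_sup.mp hx
    obtain ⟨a', ha', b', hb', rfl⟩ := Submodule.mem_sup.mp hy
    have e1 : ∀ (x : L), D x a' 1 = 0 := by
      intro x
      rw [hD, hQ x ⟨a', ha'⟩ 1]
      abel
    have e2 : ∀ y, D a y 1 = 0 := by
      intro y
      have := hQ y ⟨a, ha⟩ 1
      rw [hD, ← lie_skew, map_neg, this]
      abel
    have e3 : D b b' 1 = 0 := by
      obtain ⟨h1, h2⟩ := T.lie_mem hb hb'
      have e : ∀ c, c ∈ stabSub lam ⊔ P.toSubmodule →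
          T.actMap 1 c = algebraMap ℂ (U Q) (lam c) := by
        intro c hc
        rw [actMap_one, T.proj_eq_zero hc, map_zero, zero_add]
      rw [hD, e _ h1, h2, e _ hb, e _ hb', Algebra.algebraMap_eq_smul_one (lam b),
        Algebra.algebraMap_eq_smul_one (lam b'), map_smul, map_smul, LinearMap.smul_apply,
        LinearMap.smul_apply, e _ hb, e _ hb', Algebra.smul_def,
        Algebra.smul_def, map_zero, ← map_mul (algebraMap ℂ (U Q)), ← map_mul (algebraMap ℂ (U Q)),
        mul_comm (lam b)]
      abel
    have e4 := e1 b
    have e5 := e2 b'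
    have e6 := e2 a'
    rw [hD] at e3 e4 e5 e6 ⊢
    simp only [add_lie, lie_add, map_add, LinearMap.add_apply] at e3 e4 e5 e6 ⊢
    have e7 := congrArg₂ (· + ·) (congrArg₂ (· + ·) e3 e4) (congrArg₂ (· + ·) e5 e6)
    simp only [add_zero] at e7
    rw [← e7]
    abel
  · intro Y a ha
    have ha : ∀ x y, D x y a = 0 := fun x y => congrFun (congrFun ha x) y
    refine funext fun x => funext fun y => ?_
    change D x y (iota Q Y * a) = 0
    have h1 := ha x y
    have h2 := ha x ⁅y, (Y : L)⁆
    have h3 := ha ⁅x, (Y : L)⁆ y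
    have h4 : ⁅⁅x, y⁆, (Y : L)⁆ = ⁅x, ⁅y, (Y : L)⁆⁆ + ⁅⁅x, (Y : L)⁆, y⁆ := by
      rw [lie_lie, ← lie_skew ⁅x, (Y : L)⁆ y]
      abel
    rw [hD] at h1 h2 h3 ⊢
    simp only [actMap_mul, map_add, LinearMap.add_apply, h4]
    have h5 := congrArg₂ (· + ·) (congrArg (iota Q Y * ·) h1) (congrArg₂ (· + ·) h2 h3)
    simp only [add_zero, mul_zero] at h5
    rw [← h5]
    noncomm_ring

/-- The action of `U L` on `U Q`. -/
def act (T : Triangular lam P Q) : U L →ₐ[ℂ] Module.End ℂ (U Q) :=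
  UniversalEnvelopingAlgebra.lift ℂ
    { toFun := fun x => LinearMap.applyₗ x ∘ₗ T.actMap
      map_add' := fun x y => by ext u; simp
      map_smul' := fun c x => by ext u; simp
      map_lie' := fun {x y} => by
        ext u
        exact T.actMap_lie x y u }

lemma act_iota (x : L) (u : U Q) : T.act (iota L x) u = T.actMap u x := by
  rw [act, UniversalEnvelopingAlgebra.lift_ι_apply]
  rfl

lemma act_incl (u v : U Q) : T.act (incl Q u) v = u * v := by
  have := U_induction (LinearMap.ker (T.act.toLinearMap ∘ₗ (incl Q).toLinearMap
    - LinearMap.mul ℂ (U Q))) ?_ ?_ u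
  · exact sub_eq_zero.mp (LinearMap.congr_fun this v)
  · ext v; simp
  · intro Y a ha
    have ha : ∀ v, T.act (incl Q a) v = a * v :=
      fun v => sub_eq_zero.mp (LinearMap.congr_fun ha v)
    refine LinearMap.ext fun v => sub_eq_zero.mpr ?_
    change T.act (incl Q (iota Q Y * a)) v = iota Q Y * a * v
    rw [map_mul, map_mul, Module.End.mul_apply, ha, incl_iota, act_iota, actMap_mem, mul_assoc]

lemma act_incl_one (u : U Q) : T.act (incl Q u) 1 = u := by
  rw [act_incl, mul_one]

lemma act_iota_one_of_mem {x : L} (hx : x ∈ stabSub lam ⊔ P.toSubmodule) :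
    T.act (iota L x) 1 = lam x • 1 := by
  rw [act_iota, actMap_one, T.proj_eq_zero hx, map_zero, zero_add,
    Algebra.algebraMap_eq_smul_one]

lemma act_leftIdeal {a : U L} (ha : a ∈ leftIdeal lam P) : T.act a 1 = 0 := by
  induction ha using Submodule.span_induction with
  | mem a ha =>
    rcases ha with ⟨x, hx, rfl⟩ | ⟨x, hx, rfl⟩
    · rw [map_sub, LinearMap.sub_apply, T.act_iota_one_of_mem (Submodule.mem_sup_left hx)]
      simp
    · rw [T.act_iota_one_of_mem (Submodule.mem_sup_right hx), T.lam_P x hx, zero_smul]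
  | zero => simp
  | add a b _ _ ha hb => rw [map_add, LinearMap.add_apply, ha, hb, add_zero]
  | smul c a _ ha => rw [smul_eq_mul, map_mul, Module.End.mul_apply, ha, map_zero]

lemma sub_mem_leftIdeal (a : U L) : a - incl Q (T.act a 1) ∈ leftIdeal lam P := by
  let N : Submodule ℂ (U L) := (leftIdeal lam P).restrictScalars ℂ
  -- elements of `L` may be moved past `U Q`
  have key : ∀ u : U Q, ∀ x : L, iota L x * incl Q u - incl Q (T.act (iota L x) u) ∈ N := by
    intro u
    refine fun x => (Submodule.mem_iInf _).mp (U_induction (⨅ x : L, N.comap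
      (LinearMap.mulLeft ℂ (iota L x) ∘ₗ (incl Q).toLinearMap -
        (incl Q).toLinearMap ∘ₗ T.act (iota L x))) ?_ ?_ u) x
    · refine (Submodule.mem_iInf _).mpr fun x => ?_
      change iota L x * incl Q 1 - incl Q (T.act (iota L x) 1) ∈ leftIdeal lam P
      have hx : x ∈ Q.toSubmodule ⊔ (stabSub lam ⊔ P.toSubmodule) := by
        rw [T.codisjoint]; trivial
      obtain ⟨q, hq, b, hb, rfl⟩ := Submodule.mem_sup.mp hx
      obtain ⟨z, hz, p, hp, rfl⟩ := Submodule.mem_sup.mp hb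
      have e1 := T.act_iota_one_of_mem hb
      have e2 : T.act (iota L q) 1 = iota Q ⟨q, hq⟩ := by
        rw [act_iota, T.actMap_mem ⟨q, hq⟩, mul_one]
      have : iota L (q + (z + p)) * incl Q 1 - incl Q (T.act (iota L (q + (z + p))) 1) =
          (iota L z - algebraMap ℂ (U L) (lam z)) + iota L p := by
        rw [map_add (iota L) q, map_add T.act, LinearMap.add_apply, e1, e2, map_add lam,
          T.lam_P p hp, add_zero, map_one, mul_one, map_add (incl Q), incl_iota, map_smul, map_one,
          map_add (iota L), ← Algebra.algebraMap_eq_smul_one]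
        abel
      rw [this]
      exact add_mem (Submodule.subset_span (Or.inl ⟨z, hz, rfl⟩))
        (Submodule.subset_span (Or.inr ⟨p, hp, rfl⟩))
    · intro Y a ha
      have ha : ∀ x, iota L x * incl Q a - incl Q (T.act (iota L x) a) ∈ leftIdeal lam P :=
        fun x => (Submodule.mem_iInf _).mp ha x
      refine (Submodule.mem_iInf _).mpr fun x => ?_
      change iota L x * incl Q (iota Q Y * a) - incl Q (T.act (iota L x) (iota Q Y * a)) ∈
        leftIdeal lam P
      have h1 := (leftIdeal lam P).smul_mem (iota L (Y : L)) (ha x)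
      have h2 := ha ⁅x, (Y : L)⁆
      rw [smul_eq_mul] at h1
      convert add_mem h1 h2 using 1
      rw [act_iota, act_iota, act_iota, actMap_mul, map_add, map_mul, map_mul, incl_iota, iota_lie]
      noncomm_ring
  have := U_induction (N.comap (LinearMap.id - (incl Q).toLinearMap ∘ₗ
    LinearMap.applyₗ 1 ∘ₗ T.act.toLinearMap)) ?_ ?_ a
  · exact this
  · change (1 : U L) - incl Q (T.act 1 1) ∈ N
    simp
  · intro x a ha
    have ha : a - incl Q (T.act a 1) ∈ leftIdeal lam P := ha
    change iota L x * a - incl Q (T.act (iota L x * a) 1) ∈ leftIdeal lam P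
    have h1 := (leftIdeal lam P).smul_mem (iota L x) ha
    convert add_mem h1 (key (T.act a 1) x) using 1
    rw [smul_eq_mul, map_mul, Module.End.mul_apply]
    noncomm_ring

/-- The generalized Verma module is free of rank one over `U Q`. -/
lemma bijective_vermaMk : Function.Bijective (vermaMk lam P ∘ₗ (incl Q).toLinearMap) := by
  constructor
  · rw [← LinearMap.ker_eq_bot, LinearMap.ker_eq_bot']
    intro u hu
    have : incl Q u ∈ leftIdeal lam P := (Submodule.Quotient.mk_eq_zero _).mp hu
    rw [← T.act_incl_one u, T.act_leftIdeal this]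
  · intro y
    obtain ⟨a, rfl⟩ := Submodule.Quotient.mk_surjective _ y
    refine ⟨T.act a 1, ?_⟩
    have := T.sub_mem_leftIdeal a
    exact ((Submodule.Quotient.eq _).mpr this).symm

end Triangular

end Induced

/-! ### The pairing as a vacuum expectation value -/

section Pairing

variable {L : Type*} [LieRing L] [LieAlgebra ℂ L] {lam : Module.Dual ℂ L} {P Q : LieSubalgebra ℂ L}

lemma linInv_apply_of_bijective {V W : Type*} [AddCommGroup V] [Module ℂ V] [AddCommGroup W]
    [Module ℂ W] {f : V →ₗ[ℂ] W} (hf : Function.Bijective f) (v : V) : linInv f (f v) = v := by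
  rw [linInv, dif_pos hf]
  exact (LinearEquiv.ofBijective f hf).symm_apply_apply v

lemma apply_linInv_of_bijective {V W : Type*} [AddCommGroup V] [Module ℂ V] [AddCommGroup W]
    [Module ℂ W] {f : V →ₗ[ℂ] W} (hf : Function.Bijective f) (w : W) : f (linInv f w) = w := by
  obtain ⟨v, rfl⟩ := hf.2 w
  rw [linInv_apply_of_bijective hf]

lemma stabilizer_neg (lam : Module.Dual ℂ L) : stabilizer (-lam) = stabilizer lam := by
  ext x; simp [stabilizer]

lemma stabSub_neg (lam : Module.Dual ℂ L) : stabSub (-lam) = stabSub lam :=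
  SetLike.coe_injective (stabilizer_neg lam)

lemma antipode_mem_rightIdeal {a : U L} (ha : a ∈ leftIdeal lam P) :
    antipode L a ∈ rightIdeal (-lam) P := by
  induction ha using Submodule.span_induction with
  | mem a ha =>
    rcases ha with ⟨x, hx, rfl⟩ | ⟨x, hx, rfl⟩
    · have h : iota L x - algebraMap ℂ (U L) ((-lam) x) ∈ rightIdeal (-lam) P :=
        Submodule.subset_span (Or.inl ⟨x, by rwa [stabilizer_neg], rfl⟩)
      convert neg_mem h using 1
      rw [map_sub, antipode_iota, antipode_algebraMap, LinearMap.neg_apply, map_neg]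
      abel
    · have h : iota L x ∈ rightIdeal (-lam) P := Submodule.subset_span (Or.inr ⟨x, hx, rfl⟩)
      rw [antipode_iota]
      exact neg_mem h
  | zero => rw [map_zero]; exact zero_mem _
  | add a b _ _ ha hb => rw [map_add]; exact add_mem ha hb
  | smul c a _ ha =>
    rw [smul_eq_mul, antipode_mul]
    exact Submodule.smul_mem _ (MulOpposite.op (antipode L c)) ha

lemma antipode_mem_leftIdeal {a : U L} (ha : a ∈ rightIdeal lam P) :
    antipode L a ∈ leftIdeal (-lam) P := by
  induction ha using Submodule.span_induction with
  | mem a ha =>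
    rcases ha with ⟨x, hx, rfl⟩ | ⟨x, hx, rfl⟩
    · have h : iota L x - algebraMap ℂ (U L) ((-lam) x) ∈ leftIdeal (-lam) P :=
        Submodule.subset_span (Or.inl ⟨x, by rwa [stabilizer_neg], rfl⟩)
      convert neg_mem h using 1
      rw [map_sub, antipode_iota, antipode_algebraMap, LinearMap.neg_apply, map_neg]
      abel
    · have h : iota L x ∈ leftIdeal (-lam) P := Submodule.subset_span (Or.inr ⟨x, hx, rfl⟩)
      rw [antipode_iota]
      exact neg_mem h
  | zero => rw [map_zero]; exact zero_mem _
  | add a b _ _ ha hb => rw [map_add]; exact add_mem ha hb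
  | smul c a _ ha =>
    have : c • a = a * c.unop := rfl
    rw [this, antipode_mul]
    exact Submodule.smul_mem _ (antipode L c.unop) ha

lemma antipode_mem_leftIdeal_iff {a : U L} :
    antipode L a ∈ leftIdeal (-lam) P ↔ a ∈ rightIdeal lam P := by
  refine ⟨fun h => ?_, antipode_mem_leftIdeal⟩
  simpa using antipode_mem_rightIdeal h

namespace Triangular

/-- The hypotheses are symmetric under the exchange of `P` and `Q`. -/
lemma symm (T : Triangular lam P Q) : Triangular (-lam) Q P where
  lam_P x hx := by simp [T.lam_Q x hx]
  lam_Q x hx := by simp [T.lam_P x hx]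
  lie_P z hz x hx := T.lie_Q z (stabSub_neg lam ▸ hz) x hx
  lie_Q z hz x hx := T.lie_P z (stabSub_neg lam ▸ hz) x hx
  codisjoint := by
    rw [stabSub_neg, ← T.codisjoint]
    ac_rfl
  disjoint := by rw [stabSub_neg]; exact T.disjoint'
  disjoint' := by rw [stabSub_neg]; exact T.disjoint

variable (T : Triangular lam P Q)

include T

/-- The right generalized Verma module is free of rank one over `U P`. -/
lemma bijective_rightVermaMk : Function.Bijective (rightVermaMk lam Q ∘ₗ (incl P).toLinearMap) := by
  have hT := T.symm.bijective_vermaMk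
  constructor
  · rw [← LinearMap.ker_eq_bot, LinearMap.ker_eq_bot']
    intro u hu
    have h1 : incl P u ∈ rightIdeal lam Q := (Submodule.Quotient.mk_eq_zero _).mp hu
    have h2 := antipode_mem_leftIdeal h1
    rw [← incl_antipode] at h2
    have h3 : antipode P u = 0 := hT.1 (((Submodule.Quotient.mk_eq_zero _).mpr h2).trans
      (map_zero (vermaMk (-lam) Q ∘ₗ (incl P).toLinearMap)).symm)
    rw [← antipode_antipode u, h3, map_zero]
  · intro y
    obtain ⟨a, rfl⟩ := Submodule.Quotient.mk_surjective _ y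
    obtain ⟨u, hu⟩ := hT.2 (vermaMk (-lam) Q (antipode L a))
    refine ⟨antipode P u, ?_⟩
    have h1 : incl P u - antipode L a ∈ leftIdeal (-lam) Q := (Submodule.Quotient.eq _).mp hu
    refine (Submodule.Quotient.eq _).mpr ?_
    rw [← antipode_mem_leftIdeal_iff, map_sub]
    change antipode L (incl P (antipode P u)) - _ ∈ _
    rwa [incl_antipode, antipode_antipode]

/-- The linear functional on `U L` that is the counit on `U Q` and vanishes on the left ideal of the
generalized Verma module. -/
def hc (T : Triangular lam P Q) : U L →ₗ[ℂ] ℂ :=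
  (counit Q).toLinearMap ∘ₗ LinearMap.applyₗ 1 ∘ₗ T.act.toLinearMap

lemma hc_apply (a : U L) : T.hc a = counit Q (T.act a 1) := rfl

@[simp] lemma hc_one : T.hc 1 = 1 := by
  rw [hc_apply, map_one T.act, Module.End.one_apply, map_one]

lemma hc_leftIdeal {a : U L} (ha : a ∈ leftIdeal lam P) : T.hc a = 0 := by
  rw [hc_apply, T.act_leftIdeal ha, map_zero]

lemma counit_act_mem {x : L} (hx : x ∈ Q) (u : U Q) : counit Q (T.act (iota L x) u) = 0 := by
  rw [act_iota, T.actMap_mem ⟨x, hx⟩, map_mul, counit_iota, zero_mul]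

lemma counit_act_stab {z : L} (hz : z ∈ stabSub lam) (u : U Q) :
    counit Q (T.act (iota L z) u) = lam z * counit Q u := by
  have := U_induction (LinearMap.ker ((counit Q).toLinearMap ∘ₗ T.act (iota L z)
    - lam z • (counit Q).toLinearMap)) ?_ ?_ u
  · exact sub_eq_zero.mp this
  · refine sub_eq_zero.mpr ?_
    change counit Q (T.act (iota L z) 1) = lam z * counit Q 1
    rw [T.act_iota_one_of_mem (Submodule.mem_sup_left hz), map_smul, smul_eq_mul]
  · intro Y a ha
    refine sub_eq_zero.mpr ?_
    change counit Q (T.act (iota L z) (iota Q Y * a)) = lam z * counit Q (iota Q Y * a)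
    rw [act_iota, actMap_mul, map_add, map_mul, map_mul, counit_iota,
      T.actMap_mem ⟨_, T.lie_Q z hz Y Y.2⟩, map_mul, counit_iota]
    simp

lemma hc_rightIdeal {a : U L} (ha : a ∈ rightIdeal lam Q) : T.hc a = 0 := by
  suffices h : ∀ b, T.hc (a * b) = 0 by simpa using h 1
  induction ha using Submodule.span_induction with
  | mem a ha =>
    intro b
    rcases ha with ⟨x, hx, rfl⟩ | ⟨x, hx, rfl⟩
    · rw [hc_apply, map_mul, map_sub, Module.End.mul_apply, LinearMap.sub_apply, map_sub,
        T.counit_act_stab hx, AlgHom.commutes, Module.algebraMap_end_apply, map_smul, smul_eq_mul,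
        sub_self]
    · rw [hc_apply, map_mul, Module.End.mul_apply, T.counit_act_mem hx]
  | zero => simp
  | add a b _ _ ha hb => intro c; rw [add_mul, map_add, ha, hb, add_zero]
  | smul c a _ ha =>
    intro b
    have : c • a = a * c.unop := rfl
    rw [this, mul_assoc]
    exact ha _

lemma exists_eq_add (a : U L) : ∃ r ∈ rightIdeal lam Q, ∃ l ∈ leftIdeal lam P,
    a = algebraMap ℂ (U L) (T.hc a) + r + l := by
  have key : ∀ u : U Q, incl Q u - algebraMap ℂ (U L) (counit Q u) ∈ rightIdeal lam Q := by
    intro u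
    refine U_induction (((rightIdeal lam Q).restrictScalars ℂ).comap
      ((incl Q).toLinearMap - Algebra.linearMap ℂ (U L) ∘ₗ (counit Q).toLinearMap)) ?_ ?_ u
    · change incl Q 1 - algebraMap ℂ (U L) (counit Q 1) ∈ rightIdeal lam Q
      simp
    · intro Y a _
      change incl Q (iota Q Y * a) - algebraMap ℂ (U L) (counit Q (iota Q Y * a)) ∈
        rightIdeal lam Q
      rw [map_mul, map_mul, counit_iota, zero_mul, map_zero, sub_zero, incl_iota]
      exact Submodule.smul_mem _ (MulOpposite.op (incl Q a))
        (Submodule.subset_span (Or.inr ⟨Y, Y.2, rfl⟩))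
  refine ⟨_, key (T.act a 1), _, T.sub_mem_leftIdeal a, ?_⟩
  rw [hc_apply]
  abel

lemma eq_hc {φ : U L →ₗ[ℂ] ℂ} (h1 : φ 1 = 1) (hl : ∀ a ∈ leftIdeal lam P, φ a = 0)
    (hr : ∀ a ∈ rightIdeal lam Q, φ a = 0) (a : U L) : φ a = T.hc a := by
  obtain ⟨r, hr', l, hl', h⟩ := T.exists_eq_add a
  conv_lhs => rw [h]
  rw [map_add, map_add, hr r hr', hl l hl', Algebra.algebraMap_eq_smul_one, map_smul, h1]
  simp

lemma hc_antipode (a : U L) : T.symm.hc (antipode L a) = T.hc a := by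
  refine T.eq_hc (φ := T.symm.hc ∘ₗ antipode L) (by simp) (fun a ha => ?_) (fun a ha => ?_) a
  · exact T.symm.hc_rightIdeal (antipode_mem_rightIdeal ha)
  · exact T.symm.hc_leftIdeal (antipode_mem_leftIdeal ha)

/-- The bilinear map `(a, b) ↦ hc (a b)` descends to the two generalized Verma modules. -/
def hcPairing (T : Triangular lam P Q) : RightVerma lam Q →ₗ[ℂ] Verma lam P →ₗ[ℂ] ℂ :=
  LinearMap.compl₁₂
    (Submodule.liftQ ((rightIdeal lam Q).restrictScalars ℂ)
      (LinearMap.flip (Submodule.liftQ ((leftIdeal lam P).restrictScalars ℂ)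
        ((LinearMap.mul ℂ (U L)).compr₂ T.hc).flip
        (fun b hb => by
          ext a
          exact T.hc_leftIdeal (Submodule.smul_mem _ a hb))))
      (fun a ha => by
        refine LinearMap.ext fun y => ?_
        obtain ⟨b, rfl⟩ := Submodule.Quotient.mk_surjective _ y
        exact T.hc_rightIdeal (Submodule.smul_mem _ (MulOpposite.op b) ha)))
    (Submodule.Quotient.restrictScalarsEquiv ℂ (rightIdeal lam Q)).symm.toLinearMap
    (Submodule.Quotient.restrictScalarsEquiv ℂ (leftIdeal lam P)).symm.toLinearMap

lemma hcPairing_mk (a b : U L) :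
    T.hcPairing (rightVermaMk lam Q a) (vermaMk lam P b) = T.hc (a * b) := rfl

/-- The functional on the balanced tensor product induced by `hc`. -/
def scalarMap (T : Triangular lam P Q) : BalancedTensor lam P Q →ₗ[ℂ] ℂ :=
  Submodule.liftQ _ (TensorProduct.lift T.hcPairing) (by
    rw [balancing, Submodule.span_le]
    rintro _ ⟨x, w, y, rfl⟩
    obtain ⟨a, rfl⟩ := Submodule.Quotient.mk_surjective _ x
    obtain ⟨b, rfl⟩ := Submodule.Quotient.mk_surjective _ y
    rw [SetLike.mem_coe, LinearMap.mem_ker, map_sub, TensorProduct.lift.tmul,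
      TensorProduct.lift.tmul, sub_eq_zero]
    change T.hc (a * w * b) = T.hc (a * (w * b))
    rw [mul_assoc])

lemma mk_eq_smul (a b : U L) :
    (balancing lam P Q).mkQ (rightVermaMk lam Q a ⊗ₜ[ℂ] vermaMk lam P b) =
      T.hc (a * b) • (balancing lam P Q).mkQ (rightVermaMk lam Q 1 ⊗ₜ[ℂ] vermaMk lam P 1) := by
  obtain ⟨r, hr, l, hl, h⟩ := T.exists_eq_add (a * b)
  have hmove : ∀ c d : U L,
      (balancing lam P Q).mkQ (rightVermaMk lam Q (c * d) ⊗ₜ[ℂ] vermaMk lam P 1) =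
      (balancing lam P Q).mkQ (rightVermaMk lam Q c ⊗ₜ[ℂ] vermaMk lam P d) := by
    intro c d
    refine (Submodule.Quotient.eq _).mpr (Submodule.subset_span
      ⟨rightVermaMk lam Q c, d, vermaMk lam P 1, ?_⟩)
    have : d • vermaMk lam P 1 = vermaMk lam P d := by
      change vermaMk lam P (d * 1) = _
      rw [mul_one]
    rw [this]
    rfl
  have h0 : rightVermaMk lam Q r = 0 := (Submodule.Quotient.mk_eq_zero _).mpr hr
  have h1 : vermaMk lam P l = 0 := (Submodule.Quotient.mk_eq_zero _).mpr hl
  have h2 := hmove 1 l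
  rw [h1, TensorProduct.tmul_zero, map_zero, one_mul] at h2
  have h3 : rightVermaMk lam Q (a * b) =
      T.hc (a * b) • rightVermaMk lam Q 1 + rightVermaMk lam Q l := by
    conv_lhs => rw [h]
    rw [map_add, map_add, h0, add_zero, Algebra.algebraMap_eq_smul_one, map_smul]
  rw [← hmove, h3, TensorProduct.add_tmul, map_add, h2, add_zero, ← TensorProduct.smul_tmul',
    map_smul]

lemma toScalar_mk (a b : U L) :
    toScalar lam P Q ((balancing lam P Q).mkQ (rightVermaMk lam Q a ⊗ₜ[ℂ] vermaMk lam P b)) =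
      T.hc (a * b) := by
  set e := (balancing lam P Q).mkQ (rightVermaMk lam Q 1 ⊗ₜ[ℂ] vermaMk lam P 1) with he
  have h1 : T.scalarMap e = 1 := by
    change T.hcPairing (rightVermaMk lam Q 1) (vermaMk lam P 1) = 1
    rw [hcPairing_mk, mul_one, hc_one]
  have hb : Function.Bijective (LinearMap.toSpanSingleton ℂ (BalancedTensor lam P Q) e) := by
    constructor
    · intro c d hcd
      have := congrArg T.scalarMap hcd
      simpa [h1] using this
    · rw [← LinearMap.range_eq_top, eq_top_iff]
      rintro y -
      obtain ⟨t, rfl⟩ := Submodule.Quotient.mk_surjective _ y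
      induction t using TensorProduct.induction_on with
      | zero => exact zero_mem _
      | add s t hs ht => exact add_mem hs ht
      | tmul x y =>
        obtain ⟨a, rfl⟩ := Submodule.Quotient.mk_surjective _ x
        obtain ⟨b, rfl⟩ := Submodule.Quotient.mk_surjective _ y
        exact ⟨T.hc (a * b), (T.mk_eq_smul a b).symm⟩
  rw [T.mk_eq_smul, map_smul, toScalar, ← he]
  have h2 := linInv_apply_of_bijective hb 1
  rw [LinearMap.toSpanSingleton_apply, one_smul] at h2
  rw [h2, smul_eq_mul, mul_one]

lemma pairing_eq (u : U P) (v : U Q) :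
    pairing lam P Q u v = T.hc (antipode L (incl P u) * incl Q v) := by
  rw [← T.toScalar_mk, ← incl_antipode]
  rfl

lemma pairing_symm (u : U P) (v : U Q) : pairing (-lam) Q P v u = pairing lam P Q u v := by
  rw [T.pairing_eq, T.symm.pairing_eq, ← T.hc_antipode]
  simp

end Triangular

end Pairing

section Roots

variable {L : Type*} [LieRing L] [LieAlgebra ℂ L] [FiniteDimensional ℂ L] [IsSemisimple ℂ L]
variable {H : LieSubalgebra ℂ L} [H.IsCartanSubalgebra] {lam : Module.Dual ℂ L}

/-! ### The bilinear form and the stabilizer -/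

lemma form_eq (μ ν : Module.Dual ℂ H) : form H μ ν = μ ((cartanEquivDual H).symm ν) := by
  have h : cartanEquivDual H ((cartanEquivDual H).symm μ) ((cartanEquivDual H).symm ν) =
      μ ((cartanEquivDual H).symm ν) := by
    rw [LinearEquiv.apply_symm_apply]
  rw [← h]
  rfl

lemma form_comm (μ ν : Module.Dual ℂ H) : form H μ ν = form H ν μ := by
  rw [form, form, killingForm, LieModule.traceForm_comm]

lemma form_add_left (μ μ' ν : Module.Dual ℂ H) :
    form H (μ + μ') ν = form H μ ν + form H μ' ν := by
  simp [form_eq]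

lemma form_neg_left (μ ν : Module.Dual ℂ H) : form H (-μ) ν = -form H μ ν := by
  simp [form_eq]

lemma form_neg_right (μ ν : Module.Dual ℂ H) : form H μ (-ν) = -form H μ ν := by
  simp [form_eq]

lemma form_sub_left (μ μ' ν : Module.Dual ℂ H) :
    form H (μ - μ') ν = form H μ ν - form H μ' ν := by
  simp [form_eq]

lemma form_sub_right (μ ν ν' : Module.Dual ℂ H) :
    form H μ (ν - ν') = form H μ ν - form H μ ν' := by
  simp [form_eq]

lemma form_smul_left (c : ℂ) (μ ν : Module.Dual ℂ H) : form H (c • μ) ν = c * form H μ ν := by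
  simp [form_eq]

lemma form_zero_left (ν : Module.Dual ℂ H) : form H 0 ν = 0 := by
  simp [form_eq]

lemma form_sum_left {I : Type*} (s : Finset I) (f : I → Module.Dual ℂ H) (ν : Module.Dual ℂ H) :
    form H (∑ i ∈ s, f i) ν = ∑ i ∈ s, form H (f i) ν := by
  simp [form_eq, LinearMap.sum_apply]

lemma killing_sharp (lam : Module.Dual ℂ L) (x : L) : killingForm ℂ L (sharp lam) x = lam x := by
  rw [← LinearMap.BilinForm.toDual_def (IsKilling.killingForm_nondegenerate ℂ L), sharp,
    LinearEquiv.apply_symm_apply]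

lemma cartanEquivDual_symm_restr (hlam : sharp lam ∈ H) :
    (cartanEquivDual H).symm (restr H lam) = ⟨sharp lam, hlam⟩ := by
  rw [LinearEquiv.symm_apply_eq]
  ext x
  exact (killing_sharp lam x).symm

lemma form_restr (hlam : sharp lam ∈ H) (μ : Module.Dual ℂ H) :
    form H μ (restr H lam) = μ ⟨sharp lam, hlam⟩ := by
  rw [form_eq, cartanEquivDual_symm_restr hlam]

lemma mem_stabSub_iff_lie_sharp {x : L} : x ∈ stabSub lam ↔ ⁅sharp lam, x⁆ = 0 := by
  rw [mem_stabSub]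
  constructor
  · intro h
    refine (IsKilling.killingForm_nondegenerate ℂ L).1 _ fun y => ?_
    rw [killingForm, LieModule.traceForm_apply_lie_apply]
    exact (killing_sharp lam _).trans (h y)
  · intro h y
    rw [← killing_sharp, killingForm, ← LieModule.traceForm_apply_lie_apply, h]
    simp

lemma lie_sharp (hlam : sharp lam ∈ H) {χ : Weight ℂ H L} {x : L} (hx : x ∈ rootSpace H χ) :
    ⁅sharp lam, x⁆ = form H χ.toLinear (restr H lam) • x := by
  rw [form_restr hlam]
  exact lie_eq_smul_of_mem_rootSpace hx ⟨sharp lam, hlam⟩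

lemma mem_stabSub_of_form_eq_zero (hlam : sharp lam ∈ H) {χ : Weight ℂ H L}
    (hχ : form H χ.toLinear (restr H lam) = 0) {x : L} (hx : x ∈ rootSpace H χ) :
    x ∈ stabSub lam := by
  rw [mem_stabSub_iff_lie_sharp, lie_sharp hlam hx, hχ, zero_smul]

lemma apply_eq_zero_of_mem_rootSpace (hlam : sharp lam ∈ H) {χ : Weight ℂ H L} (hχ : χ.IsNonZero)
    {x : L} (hx : x ∈ rootSpace H χ) : lam x = 0 := by
  rw [← killing_sharp]
  refine killingForm_apply_eq_zero_of_mem_rootSpace_of_add_ne_zero ℂ L H (α := 0)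
    (toLieSubmodule_le_rootSpace_zero ℂ L H hlam) hx ?_
  rw [zero_add]
  exact hχ

/-! ### Sums of positive roots -/

lemma exists_weight_add {α β : Weight ℂ H L} (hα : α.IsNonZero) {n : ℤ} (hn : n < 0)
    (h : β (coroot α) = n) : ∃ γ : Weight ℂ H L, γ.toLinear = α.toLinear + β.toLinear := by
  have h1 := apply_coroot_eq_cast α β
  rw [h] at h1
  have h2 : n = chainBotCoeff α β - chainTopCoeff α β := by exact_mod_cast h1
  have h3 := (rootSpace_zsmul_add_ne_bot_iff α β hα 1).mpr ⟨by omega, by omega⟩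
  refine ⟨⟨_, h3⟩, ?_⟩
  ext x
  simp

namespace InvariantOrdering

variable (O : InvariantOrdering H lam)

lemma isNonZero_of_mem_pos {α : Weight ℂ H L} (hα : α ∈ O.pos) : α.IsNonZero := by
  simpa using O.pos_subset hα

/-- A shortest vanishing sum of positive roots could be shortened: the pairings of its members with
the coroot of the first one add up to zero, so one of them is negative, and the sum of the two roots
is again a positive root. -/
lemma sum_ne_zero (l : List (Weight ℂ H L)) (hl : ∀ α ∈ l, α ∈ O.pos) (hne : l ≠ []) :
    (l.map fun α => α.toLinear).sum ≠ 0 := by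
  classical
  induction hn : l.length using Nat.strong_induction_on generalizing l with
  | _ n ih =>
    intro h0
    obtain ⟨α, t, rfl⟩ := List.exists_cons_of_ne_nil hne
    have hα := hl α List.mem_cons_self
    have hα0 := O.isNonZero_of_mem_pos hα
    have hz : ∀ β : Weight ℂ H L, ∃ n : ℤ, β (coroot α) = n :=
      fun β => ⟨_, apply_coroot_eq_cast α β⟩
    choose z hz using hz
    have hex : ∃ β ∈ t, z β < 0 := by
      by_contra! hcon
      have h1 : ((t.map fun α : Weight ℂ H L => α.toLinear).sum) (coroot α) = ((t.map z).sum : ℤ) := by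
        clear hl hne hn h0 hcon
        induction t with
        | nil => simp
        | cons β t iht => simp [iht, hz]
      have h2 : 0 ≤ (t.map z).sum := List.sum_nonneg (by
        intro x hx
        obtain ⟨β, hβ, rfl⟩ := List.mem_map.mp hx
        exact hcon β hβ)
      have h3 := LinearMap.congr_fun h0 (coroot α)
      rw [List.map_cons, List.sum_cons, LinearMap.add_apply, h1, Weight.toLinear_apply,
        root_apply_coroot hα0, LinearMap.zero_apply] at h3
      have h4 : (2 : ℤ) + (t.map z).sum = 0 := by exact_mod_cast h3
      omega
    obtain ⟨β, hβ, hneg⟩ := hex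
    obtain ⟨γ, hγ⟩ := exists_weight_add hα0 hneg (hz β)
    have hγpos : γ ∈ O.pos :=
      O.pos_closed α hα β (hl β (List.mem_cons_of_mem _ hβ)) γ hγ
    have hperm := (List.perm_cons_erase hβ)
    have hlen := hperm.length_eq
    refine ih (γ :: t.erase β).length ?_ (γ :: t.erase β) ?_ (by simp) rfl ?_
    · simp only [List.length_cons] at hlen hn ⊢
      omega
    · intro δ hδ
      rcases List.mem_cons.mp hδ with rfl | hδ
      · exact hγpos
      · exact hl δ (List.mem_cons_of_mem _ (List.mem_of_mem_erase hδ))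
    · rw [List.map_cons, List.sum_cons, (hperm.map _).sum_eq, List.map_cons, List.sum_cons] at h0
      rw [List.map_cons, List.sum_cons, hγ, ← h0]
      abel

lemma wt_cons (a : {α // α ∈ O.pos}) (w : O.Word) : O.wt (a :: w) = a.1.toLinear + O.wt w := by
  simp [wt]

@[simp] lemma wt_nil : O.wt [] = 0 := rfl

lemma wt_append (w w' : O.Word) : O.wt (w ++ w') = O.wt w + O.wt w' := by
  simp [wt]

lemma wt_ne_zero {w : O.Word} (hw : w ≠ []) : O.wt w ≠ 0 := by
  have := O.sum_ne_zero (w.map fun a => a.1) (fun α hα => ?_) (fun h => hw ?_)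
  · rwa [List.map_map] at this
  · obtain ⟨a, -, rfl⟩ := List.mem_map.mp hα
    exact a.2
  · exact List.map_eq_nil_iff.mp h

/-- The multiplicity vectors of the words of a given weight form an antichain, because a non-empty
sum of positive roots does not vanish, so that Dickson's lemma applies. -/
lemma finite_wt_eq (μ : Module.Dual ℂ H) : {w : O.Word | O.wt w = μ}.Finite := by
  classical
  let cnt : O.Word → ({α // α ∈ O.pos} → ℕ) := fun w a => w.count a
  have hanti : IsAntichain (· ≤ ·) (cnt '' {w : O.Word | O.wt w = μ}) := by
    rintro _ ⟨w, hw, rfl⟩ _ ⟨w', hw', rfl⟩ hne hle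
    have hsub : w.Subperm w' := List.subperm_ext_iff.mpr fun a _ => hle a
    obtain ⟨s, hs⟩ := Multiset.le_iff_exists_add.mp (Multiset.coe_le.mpr hsub)
    obtain ⟨l, rfl⟩ := Quot.exists_rep s
    have hl : w'.Perm (w ++ l) := Multiset.coe_eq_coe.mp hs
    have h1 : O.wt w' = O.wt w + O.wt l := by
      rw [← O.wt_append]
      exact (hl.map _).sum_eq
    have h2 : O.wt l = 0 := by
      rw [hw, hw'] at h1
      simpa using h1
    have h3 : l = [] := by
      by_contra h
      exact O.wt_ne_zero h h2
    apply hne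
    funext a
    simp [cnt, hl.count_eq, h3]
  have hfin : (cnt '' {w : O.Word | O.wt w = μ}).Finite :=
    WellQuasiOrderedLE.finite_of_isAntichain hanti
  obtain ⟨N, hN⟩ : ∃ N, ∀ c ∈ cnt '' {w : O.Word | O.wt w = μ}, ∑ a, c a ≤ N := by
    obtain ⟨N, hN⟩ := (hfin.image fun c => ∑ a, c a).bddAbove
    exact ⟨N, fun c hc => hN ⟨c, hc, rfl⟩⟩
  refine (List.finite_length_le _ N).subset fun w hw => ?_
  have := hN _ ⟨w, hw, rfl⟩
  have hlen : ∑ a, cnt w a = w.length := by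
    have h := Multiset.sum_count_eq_card (s := Finset.univ)
      (m := (w : Multiset {α // α ∈ O.pos})) fun a _ => Finset.mem_univ a
    rw [Multiset.coe_card] at h
    rw [← h]
    refine Finset.sum_congr rfl fun a _ => ?_
    rw [Multiset.coe_count]
    simp only [cnt]
    congr!
  simpa [← hlen] using this

lemma exists_word_of_mem_hatCone {μ : Module.Dual ℂ H} (hμ : μ ∈ O.hatCone) :
    ∃ w : O.Word, (∀ a ∈ w, a.1 ∈ O.hatPos) ∧ O.wt w = μ := by
  induction hμ using AddSubmonoid.closure_induction with
  | mem μ h =>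
    obtain ⟨α, hα, rfl⟩ := h
    exact ⟨[⟨α, hα.1⟩], by simpa using hα, by simp [wt]⟩
  | zero => exact ⟨[], by simp, rfl⟩
  | add μ ν _ _ h1 h2 =>
    obtain ⟨w, hw, rfl⟩ := h1
    obtain ⟨w', hw', rfl⟩ := h2
    refine ⟨w ++ w', fun a ha => ?_, O.wt_append w w'⟩
    rcases List.mem_append.mp ha with h | h
    exacts [hw a h, hw' a h]

lemma wt_mem_hatCone_of_mem_wordsTilde {w : O.Word} (hw : w ∈ O.wordsTilde) :
    O.wt w ∈ O.hatCone := by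
  rcases w with _ | ⟨a, w⟩
  · exact zero_mem _
  · exact hw 0 (by simp)

lemma nil_mem_wordsTilde : ([] : O.Word) ∈ O.wordsTilde := by
  intro i hi
  simp at hi

lemma cons_mem_wordsTilde_iff {a : {α // α ∈ O.pos}} {w : O.Word} :
    a :: w ∈ O.wordsTilde ↔ O.wt (a :: w) ∈ O.hatCone ∧ w ∈ O.wordsTilde := by
  constructor
  · intro h
    refine ⟨h 0 (by simp), fun i hi => ?_⟩
    exact h (i + 1) (by simpa using hi)
  · rintro ⟨h1, h2⟩ i hi
    rcases i with _ | i
    · exact h1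
    · exact h2 i (by simpa using hi)

lemma p_wt_ne_zero (hO : O.MemOmegaTilde) {w : O.Word} (hw : w ∈ O.wordsTilde) {i : ℕ}
    (hi : i < w.length) : O.p (O.wt (w.drop i)) ≠ 0 :=
  hO _ (hw i hi) (O.wt_ne_zero (by simpa using hi))

lemma pWord_wt (w : O.Word) :
    O.pWord w (O.wt w) = ∏ i ∈ Finset.range w.length, O.p (O.wt (w.drop i)) := by
  refine Finset.prod_congr rfl fun i _ => ?_
  have := O.wt_append (w.take i) (w.drop i)
  rw [List.take_append_drop] at this
  rw [this, add_sub_cancel_left]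

/-! ### The grading -/

open Classical in
/-- Decomposing a positive root repeatedly into sums of two positive roots ends with simple roots. -/
lemma exists_word_simple (α : {α // α ∈ O.pos}) :
    ∃ w : O.Word, (∀ a ∈ w, a.1 ∈ O.simple) ∧ O.wt w = α.1.toLinear := by
  -- `β < α` if `α - β` is a non-empty sum of positive roots; this is a strict order
  let r : {α // α ∈ O.pos} → {α // α ∈ O.pos} → Prop := fun β α =>
    ∃ w : O.Word, w ≠ [] ∧ α.1.toLinear = β.1.toLinear + O.wt w
  have : IsTrans _ r := ⟨by
    rintro α β γ ⟨w, hw, h⟩ ⟨w', hw', h'⟩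
    exact ⟨w ++ w', by simp [hw], by rw [h', h, O.wt_append, add_assoc]⟩⟩
  have : Std.Irrefl r := ⟨by
    rintro α ⟨w, hw, h⟩
    exact O.wt_ne_zero hw (by simpa using h)⟩
  have hwf : WellFounded r := Finite.wellFounded_of_trans_of_irrefl r
  induction α using hwf.induction with
  | _ α ih =>
    by_cases hα : α.1 ∈ O.simple
    · exact ⟨[α], by simpa using hα, by simp [wt]⟩
    · have : ∃ β ∈ O.pos, ∃ γ ∈ O.pos, α.1.toLinear = β.toLinear + γ.toLinear := by
        by_contra h
        exact hα (by simp only [simple, Finset.mem_filter]; exact ⟨α.2, h⟩)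
      obtain ⟨β, hβ, γ, hγ, h⟩ := this
      obtain ⟨w, hw, hw'⟩ := ih ⟨β, hβ⟩ ⟨[⟨γ, hγ⟩], by simp, by simpa [wt] using h⟩
      obtain ⟨v, hv, hv'⟩ := ih ⟨γ, hγ⟩ ⟨[⟨β, hβ⟩], by simp, by
        rw [h, add_comm]; simp [wt]⟩
      refine ⟨w ++ v, fun a ha => ?_, by rw [O.wt_append, hw', hv', h]⟩
      rcases List.mem_append.mp ha with h | h
      exacts [hw a h, hv a h]

variable {O} in
lemma HasDegree.add {μ ν : Module.Dual ℂ H} {m n : ℤ} (hμ : O.HasDegree μ m)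
    (hν : O.HasDegree ν n) : O.HasDegree (μ + ν) (m + n) := by
  obtain ⟨c, rfl, rfl⟩ := hμ
  obtain ⟨d, rfl, rfl⟩ := hν
  exact ⟨c + d, by simp [add_smul, Finset.sum_add_distrib], by simp [Finset.sum_add_distrib]⟩

variable {O} in
lemma HasDegree.neg {μ : Module.Dual ℂ H} {m : ℤ} (hμ : O.HasDegree μ m) :
    O.HasDegree (-μ) (-m) := by
  obtain ⟨c, rfl, rfl⟩ := hμ
  exact ⟨-c, by simp, by simp⟩

lemma hasDegree_zero : O.HasDegree 0 0 := ⟨0, by simp, by simp⟩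

open Classical in
lemma hasDegree_simple {β : Weight ℂ H L} (hβ : β ∈ O.simple) :
    O.HasDegree β.toLinear (if β ∈ O.hatPos then 1 else 0) := by
  refine ⟨fun γ => if γ = β then 1 else 0, ?_, ?_⟩
  · simp [hβ]
  · simp only [Finset.sum_ite_eq', Finset.mem_filter, hβ, true_and]

/-- A positive root not orthogonal to `lam` has a positive degree: otherwise it would be a sum of
simple roots orthogonal to `lam`. -/
lemma exists_degree (α : {α // α ∈ O.hatPos}) :
    ∃ d : ℕ, 1 ≤ d ∧ O.HasDegree α.1.toLinear d := by
  classical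
  obtain ⟨w, hw, hα⟩ := O.exists_word_simple ⟨α.1, α.2.1⟩
  have key : ∀ w : O.Word, (∀ a ∈ w, a.1 ∈ O.simple) →
      O.HasDegree (O.wt w) (w.countP fun a => a.1 ∈ O.hatPos : ℕ) := by
    intro w
    induction w with
    | nil => intro _; simpa using O.hasDegree_zero
    | cons a w ih =>
      intro h
      have h1 := (O.hasDegree_simple (h a List.mem_cons_self)).add
        (ih fun b hb => h b (List.mem_cons_of_mem _ hb))
      rw [O.wt_cons, List.countP_cons]
      convert h1 using 1
      by_cases ha : a.1 ∈ O.hatPos <;> simp [ha, add_comm]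
  refine ⟨_, ?_, hα ▸ key w hw⟩
  rw [Nat.one_le_iff_ne_zero, Ne, List.countP_eq_zero]
  intro h0
  apply α.2.2
  rw [← hα, wt]
  have : ∀ w : O.Word, (∀ a ∈ w, form H a.1.toLinear (restr H lam) = 0) →
      form H (w.map fun a => a.1.toLinear).sum (restr H lam) = 0 := by
    intro w
    induction w with
    | nil => intro _; exact form_zero_left _
    | cons a w ih =>
      intro h
      rw [List.map_cons, List.sum_cons, form_add_left, h a List.mem_cons_self,
        ih fun b hb => h b (List.mem_cons_of_mem _ hb), add_zero]
  refine this w fun a ha => ?_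
  by_contra hne
  exact h0 a ha (decide_eq_true (⟨a.2, hne⟩ : a.1 ∈ O.hatPos))

lemma exists_degree_wt {w : O.Word} (hw : ∀ a ∈ w, a.1 ∈ O.hatPos) :
    ∃ d : ℕ, w.length ≤ d ∧ O.HasDegree (O.wt w) d := by
  induction w with
  | nil => exact ⟨0, le_rfl, by simpa using O.hasDegree_zero⟩
  | cons a w ih =>
    obtain ⟨d, hd, h⟩ := ih fun b hb => hw b (List.mem_cons_of_mem _ hb)
    obtain ⟨e, he, h'⟩ := O.exists_degree ⟨a.1, hw a List.mem_cons_self⟩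
    refine ⟨e + d, by simp; omega, ?_⟩
    rw [O.wt_cons]
    exact_mod_cast h'.add h

/-! ### The triangular decomposition -/

lemma form_ne_zero_of_neg {α : Weight ℂ H L} (hα : -α ∈ O.hatPos) :
    form H α.toLinear (restr H lam) ≠ 0 := by
  have := hα.2
  rwa [Weight.toLinear_neg, form_neg_left, neg_ne_zero] at this

lemma trichotomy (χ : Weight ℂ H L) :
    χ ∈ O.hatPos ∨ -χ ∈ O.hatPos ∨ form H χ.toLinear (restr H lam) = 0 := by
  by_cases h : form H χ.toLinear (restr H lam) = 0
  · exact Or.inr (Or.inr h)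
  · have hχ : χ ∈ H.root := by
      suffices χ.IsNonZero by simpa using this
      intro h0
      have h1 : χ.toLinear = 0 := by simpa using h0
      exact h (by rw [h1, form_zero_left])
    rcases O.mem_or_neg_mem χ hχ with h1 | h1
    · exact Or.inl ⟨h1, h⟩
    · refine Or.inr (Or.inl ⟨h1, ?_⟩)
      rwa [Weight.toLinear_neg, form_neg_left, neg_ne_zero]

lemma disjoint_iSup_rootSpace {s t : Set (Weight ℂ H L)} (hst : Disjoint s t) :
    Disjoint (⨆ α ∈ s, (rootSpace H α).toSubmodule) (⨆ α ∈ t, (rootSpace H α).toSubmodule) := by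
  have h := (LieSubmodule.iSupIndep_toSubmodule).mpr (iSupIndep_genWeightSpace' ℂ H L)
  exact h.disjoint_biSup_biSup' hst (Set.toFinite s)

lemma notMem_hatPos_of_neg {α : Weight ℂ H L} (hα : -α ∈ O.hatPos) : α ∉ O.hatPos := fun h =>
  O.neg_notMem α h.1 hα.1

variable (H lam) in
/-- The weights orthogonal to `lam`, including `0`. -/
def nullWeights : Set (Weight ℂ H L) := {χ | form H χ.toLinear (restr H lam) = 0}

lemma mem_iSup_rootSpace {s : Set (Weight ℂ H L)} {χ : Weight ℂ H L} (hχ : χ ∈ s) {x : L}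
    (hx : x ∈ rootSpace H χ) : x ∈ ⨆ α ∈ s, (rootSpace H α).toSubmodule :=
  Submodule.mem_iSup_of_mem χ (Submodule.mem_iSup_of_mem hχ hx)

lemma iSup_rootSpace_eq_top :
    (⨆ α ∈ O.hatPos, (rootSpace H α).toSubmodule) ⊔
      (⨆ α ∈ {α | -α ∈ O.hatPos}, (rootSpace H α).toSubmodule) ⊔
      (⨆ α ∈ nullWeights H lam, (rootSpace H α).toSubmodule) = ⊤ := by
  rw [eq_top_iff, ← LieSubmodule.top_toSubmodule (L := H), ← iSup_genWeightSpace_eq_top' ℂ H L,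
    LieSubmodule.iSup_toSubmodule, iSup_le_iff]
  intro χ x hx
  rcases O.trichotomy χ with h | h | h
  · exact Submodule.mem_sup_left (Submodule.mem_sup_left (mem_iSup_rootSpace h hx))
  · exact Submodule.mem_sup_left (Submodule.mem_sup_right
      (mem_iSup_rootSpace (s := {α | -α ∈ O.hatPos}) h hx))
  · exact Submodule.mem_sup_right (mem_iSup_rootSpace h hx)

lemma iSup_nullWeights_le (hlam : sharp lam ∈ H) :
    (⨆ α ∈ nullWeights H lam, (rootSpace H α).toSubmodule) ≤ stabSub lam :=
  iSup₂_le fun _ hα _ hx => mem_stabSub_of_form_eq_zero hlam hα hx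

include O in
lemma stabSub_eq (hlam : sharp lam ∈ H) :
    stabSub lam = ⨆ α ∈ nullWeights H lam, (rootSpace H α).toSubmodule := by
  refine le_antisymm (fun x hx => ?_) (iSup_nullWeights_le hlam)
  have hx' : x ∈ (⊤ : Submodule ℂ L) := trivial
  rw [← O.iSup_rootSpace_eq_top] at hx'
  obtain ⟨a, ha, z, hz, rfl⟩ := Submodule.mem_sup.mp hx'
  -- `a` commutes with `sharp lam`, but it is a sum of eigenvectors with nonzero eigenvalues
  have ha0 : a ∈ stabSub lam := by
    have := sub_mem hx (iSup_nullWeights_le hlam hz)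
    rwa [add_sub_cancel_right] at this
  have h1 : a ∈ (LieModule.toEnd ℂ L L (sharp lam)).eigenspace 0 := by
    rw [Module.End.mem_eigenspace_iff, zero_smul]
    exact mem_stabSub_iff_lie_sharp.mp ha0
  have h2 : a ∈ ⨆ c, ⨆ (_ : c ≠ 0), (LieModule.toEnd ℂ L L (sharp lam)).eigenspace c := by
    refine (sup_le (iSup₂_le fun α hα y hy => ?_) (iSup₂_le fun α hα y hy => ?_) :
      _ ≤ ⨆ c, ⨆ (_ : c ≠ 0), (LieModule.toEnd ℂ L L (sharp lam)).eigenspace c) ha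
    · exact Submodule.mem_iSup_of_mem _ (Submodule.mem_iSup_of_mem hα.2
        (Module.End.mem_eigenspace_iff.mpr (lie_sharp hlam hy)))
    · exact Submodule.mem_iSup_of_mem _ (Submodule.mem_iSup_of_mem (O.form_ne_zero_of_neg hα)
        (Module.End.mem_eigenspace_iff.mpr (lie_sharp hlam hy)))
  have h3 := Submodule.disjoint_def.mp
    (Module.End.eigenspaces_iSupIndep (LieModule.toEnd ℂ L L (sharp lam)) 0) a h1 h2
  rw [h3, zero_add]
  exact hz

lemma lie_mem_iSup_rootSpace {s t : Set (Weight ℂ H L)}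
    (hst : ∀ α ∈ s, ∀ β ∈ t, ∀ γ : Weight ℂ H L,
      γ.toLinear = α.toLinear + β.toLinear → γ ∈ t) {x y : L}
    (hx : x ∈ ⨆ α ∈ s, (rootSpace H α).toSubmodule)
    (hy : y ∈ ⨆ α ∈ t, (rootSpace H α).toSubmodule) :
    ⁅x, y⁆ ∈ ⨆ α ∈ t, (rootSpace H α).toSubmodule := by
  have hx' : (⨆ α ∈ s, (rootSpace H α).toSubmodule) ≤
      (⨆ α ∈ t, (rootSpace H α).toSubmodule).comap
        ((LieModule.toEnd ℂ L L : L →ₗ[ℂ] Module.End ℂ L).flip y) := by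
    refine iSup₂_le fun α hα a ha => ?_
    change ⁅a, y⁆ ∈ ⨆ α ∈ t, (rootSpace H α).toSubmodule
    have hy' : (⨆ α ∈ t, (rootSpace H α).toSubmodule) ≤
        (⨆ α ∈ t, (rootSpace H α).toSubmodule).comap (LieModule.toEnd ℂ L L a) := by
      refine iSup₂_le fun β hβ b hb => ?_
      have hab := lie_mem_genWeightSpace_of_mem_genWeightSpace ha hb
      by_cases h : genWeightSpace L ((α : H → ℂ) + (β : H → ℂ)) = ⊥
      · rw [h, LieSubmodule.mem_bot] at hab
        change ⁅a, b⁆ ∈ ⨆ α ∈ t, (rootSpace H α).toSubmodule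
        rw [hab]
        exact Submodule.zero_mem _
      · exact mem_iSup_rootSpace (χ := ⟨(α : H → ℂ) + (β : H → ℂ), h⟩)
          (hst α hα β hβ _ (by ext; rfl)) hab
    exact hy' hy
  exact hx' hx

lemma hatPos_invariant : ∀ β ∈ nullWeights H lam, ∀ α ∈ O.hatPos, ∀ γ : Weight ℂ H L,
    γ.toLinear = β.toLinear + α.toLinear → γ ∈ O.hatPos := by
  intro β hβ α hα γ h
  have hγ : form H γ.toLinear (restr H lam) ≠ 0 := by
    rw [h, form_add_left, show form H β.toLinear (restr H lam) = 0 from hβ, zero_add]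
    exact hα.2
  have hγ0 : γ ∈ H.root := by
    suffices γ.IsNonZero by simpa using this
    intro h0
    have h1 : γ.toLinear = 0 := by simpa using h0
    exact hγ (by rw [h1, form_zero_left])
  by_cases h0 : β.IsZero
  · have h1 : β.toLinear = 0 := by simpa using h0
    rw [h1, zero_add] at h
    have : γ = α := by
      ext x
      exact LinearMap.congr_fun h x
    rwa [this]
  · have hβ0 : β ∈ H.root := by
      suffices β.IsNonZero by simpa using this
      exact h0
    exact ⟨O.invariant α hα.1 hα.2 β hβ0 hβ γ hγ0 (by rw [h, add_comm]), hγ⟩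

lemma neg_hatPos_invariant : ∀ β ∈ nullWeights H lam, ∀ α ∈ {α : Weight ℂ H L | -α ∈ O.hatPos},
    ∀ γ : Weight ℂ H L, γ.toLinear = β.toLinear + α.toLinear →
      γ ∈ {α : Weight ℂ H L | -α ∈ O.hatPos} := by
  intro β hβ α hα γ h
  refine O.hatPos_invariant (-β) ?_ (-α) hα (-γ) ?_
  · change form H _ _ = 0
    rw [Weight.toLinear_neg, form_neg_left, show form H β.toLinear (restr H lam) = 0 from hβ,
      neg_zero]
  · rw [Weight.toLinear_neg, Weight.toLinear_neg, Weight.toLinear_neg, h]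
    abel

lemma apply_eq_zero_of_mem_iSup (hlam : sharp lam ∈ H) {s : Set (Weight ℂ H L)}
    (hs : ∀ α ∈ s, form H α.toLinear (restr H lam) ≠ 0) {x : L}
    (hx : x ∈ ⨆ α ∈ s, (rootSpace H α).toSubmodule) : lam x = 0 := by
  refine (iSup₂_le fun α hα y hy => ?_ :
    (⨆ α ∈ s, (rootSpace H α).toSubmodule) ≤ LinearMap.ker lam) hx
  refine apply_eq_zero_of_mem_rootSpace hlam (fun h0 => hs α hα ?_) hy
  have h1 : α.toLinear = 0 := by simpa using h0
  rw [h1, form_zero_left]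

lemma triangular (hlam : sharp lam ∈ H) : Triangular lam O.nHatPos O.nHatNeg := by
  have h1 : Disjoint O.hatPos {α | -α ∈ O.hatPos} :=
    Set.disjoint_left.mpr fun α h h' => O.notMem_hatPos_of_neg h' h
  have h2 : Disjoint (nullWeights H lam) O.hatPos := Set.disjoint_left.mpr fun α h h' => h'.2 h
  have h3 : Disjoint (nullWeights H lam) {α | -α ∈ O.hatPos} :=
    Set.disjoint_left.mpr fun α h h' => O.form_ne_zero_of_neg h' h
  have hP : O.nHatPos.toSubmodule = ⨆ α ∈ O.hatPos, (rootSpace H α).toSubmodule := rfl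
  have hQ : O.nHatNeg.toSubmodule = ⨆ α ∈ {α | -α ∈ O.hatPos}, (rootSpace H α).toSubmodule := rfl
  have hS := O.stabSub_eq hlam
  refine ⟨fun x hx => ?_, fun x hx => ?_, fun z hz x hx => ?_, fun z hz x hx => ?_, ?_, ?_, ?_⟩
  · exact apply_eq_zero_of_mem_iSup hlam (fun α hα => hα.2) hx
  · exact apply_eq_zero_of_mem_iSup hlam (fun α hα => O.form_ne_zero_of_neg hα) hx
  · rw [hS] at hz
    exact lie_mem_iSup_rootSpace O.hatPos_invariant hz hx
  · rw [hS] at hz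
    exact lie_mem_iSup_rootSpace O.neg_hatPos_invariant hz hx
  · rw [hP, hQ, hS, ← O.iSup_rootSpace_eq_top]
    ac_rfl
  · rw [hP, hQ, hS, ← iSup_union]
    exact disjoint_iSup_rootSpace (h3.symm.union_right h1.symm)
  · rw [hP, hQ, hS, ← iSup_union]
    exact disjoint_iSup_rootSpace (h2.symm.union_right h1)

end InvariantOrdering

end Roots

section Weights

variable {L : Type*} [LieRing L] [LieAlgebra ℂ L] [FiniteDimensional ℂ L] [IsSemisimple ℂ L]
variable {H : LieSubalgebra ℂ L} [H.IsCartanSubalgebra] {lam : Module.Dual ℂ L}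

/-- The part of weight `μ` of the enveloping algebra of a sum of root spaces: the span of the products
of root vectors with roots in `s` for which the sum of the roots is `μ`. -/
def weightPiece (K : LieSubalgebra ℂ L) (s : Set (Weight ℂ H L)) (μ : Module.Dual ℂ H) :
    Submodule ℂ (U K) :=
  Submodule.span ℂ {a | ∃ l : List (Weight ℂ H L × K),
    (∀ b ∈ l, b.1 ∈ s ∧ (b.2 : L) ∈ rootSpace H b.1) ∧
    (l.map fun b => b.1.toLinear).sum = μ ∧ a = (l.map fun b => iota K b.2).prod}

variable {K : LieSubalgebra ℂ L} {s : Set (Weight ℂ H L)}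

lemma one_mem_weightPiece : (1 : U K) ∈ weightPiece K s 0 :=
  Submodule.subset_span ⟨[], by simp, by simp, by simp⟩

lemma iota_mul_mem_weightPiece {χ : Weight ℂ H L} (hχ : χ ∈ s) {x : K}
    (hx : (x : L) ∈ rootSpace H χ) {μ : Module.Dual ℂ H} {a : U K}
    (ha : a ∈ weightPiece K s μ) : iota K x * a ∈ weightPiece K s (χ.toLinear + μ) := by
  refine (Submodule.span_le.mpr ?_ : weightPiece K s μ ≤
    (weightPiece K s (χ.toLinear + μ)).comap (LinearMap.mulLeft ℂ (iota K x))) ha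
  rintro _ ⟨l, hl, hsum, rfl⟩
  refine Submodule.subset_span ⟨(χ, x) :: l, ?_, ?_, by simp⟩
  · intro b hb
    rcases List.mem_cons.mp hb with rfl | hb
    exacts [⟨hχ, hx⟩, hl b hb]
  · rw [List.map_cons, List.sum_cons, hsum]

lemma mem_iSup_weightPiece (hK : K.toSubmodule = ⨆ α ∈ s, (rootSpace H α).toSubmodule) (a : U K) :
    a ∈ ⨆ μ, weightPiece K s μ := by
  refine U_induction _ (Submodule.mem_iSup_of_mem 0 one_mem_weightPiece) (fun x a ha => ?_) a
  let N : Submodule ℂ K := (⨆ μ, weightPiece K s μ).comap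
    (LinearMap.mulRight ℂ a ∘ₗ (iota K : K →ₗ[ℂ] U K))
  have hN : ∀ χ ∈ s, ∀ x : K, (x : L) ∈ rootSpace H χ → x ∈ N := by
    intro χ hχ x hx
    refine (iSup_le fun μ b hb => ?_ : (⨆ μ, weightPiece K s μ) ≤
      (⨆ μ, weightPiece K s μ).comap (LinearMap.mulLeft ℂ (iota K x))) ha
    exact Submodule.mem_iSup_of_mem _ (iota_mul_mem_weightPiece hχ hx hb)
  have hle : K.toSubmodule ≤ N.map K.toSubmodule.subtype := by
    refine hK.le.trans (iSup₂_le fun α hα y hy => ?_)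
    have hy' : y ∈ K.toSubmodule := hK.ge (InvariantOrdering.mem_iSup_rootSpace hα hy)
    exact ⟨⟨y, hy'⟩, hN α hα _ hy, rfl⟩
  obtain ⟨y, hy, hxy⟩ := hle x.2
  rw [← show y = x from Subtype.ext hxy]
  exact hy

namespace InvariantOrdering

variable (O : InvariantOrdering H lam)

/-! ### Weights of the generalized Verma module -/

/-- The part of weight `-μ` of `U ñ⁻`. -/
def wtPiece (μ : Module.Dual ℂ H) : Submodule ℂ (U O.nHatNeg) :=
  weightPiece O.nHatNeg {α | -α ∈ O.hatPos} (-μ)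

lemma one_mem_wtPiece : (1 : U O.nHatNeg) ∈ O.wtPiece 0 := by
  rw [wtPiece, neg_zero]
  exact one_mem_weightPiece

lemma iota_mul_mem_wtPiece {χ : Weight ℂ H L} (hχ : -χ ∈ O.hatPos) {x : O.nHatNeg}
    (hx : (x : L) ∈ rootSpace H χ) {μ : Module.Dual ℂ H} {a : U O.nHatNeg}
    (ha : a ∈ O.wtPiece μ) : iota O.nHatNeg x * a ∈ O.wtPiece (μ - χ.toLinear) := by
  rw [wtPiece, neg_sub, sub_eq_add_neg]
  exact iota_mul_mem_weightPiece (s := {α | -α ∈ O.hatPos}) hχ hx ha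

lemma mem_iSup_wtPiece (a : U O.nHatNeg) : a ∈ ⨆ μ, O.wtPiece μ := by
  refine (iSup_le fun μ => ?_ : (⨆ μ, weightPiece O.nHatNeg {α | -α ∈ O.hatPos} μ) ≤
    ⨆ μ, O.wtPiece μ) (mem_iSup_weightPiece rfl a)
  conv_lhs => rw [← neg_neg μ]
  exact le_iSup O.wtPiece (-μ)

lemma wtPiece_induction {q : U O.nHatNeg → Prop} (hadd : ∀ a b, q a → q b → q (a + b))
    (hzero : q 0) (h : ∀ μ, ∀ a ∈ O.wtPiece μ, q a) (a : U O.nHatNeg) : q a :=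
  Submodule.iSup_induction O.wtPiece (motive := q) (O.mem_iSup_wtPiece a) h hzero hadd

lemma neg_sum_mem_hatCone (l : List (Weight ℂ H L × O.nHatNeg))
    (hl : ∀ b ∈ l, -b.1 ∈ O.hatPos) : -(l.map fun b => b.1.toLinear).sum ∈ O.hatCone := by
  induction l with
  | nil => simp
  | cons b l ih =>
    rw [List.map_cons, List.sum_cons, neg_add]
    refine AddMemClass.add_mem (AddSubmonoid.subset_closure ⟨-b.1, hl b List.mem_cons_self, ?_⟩)
      (ih fun c hc => hl c (List.mem_cons_of_mem _ hc))
    rw [Weight.toLinear_neg]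

lemma wtPiece_eq_bot {μ : Module.Dual ℂ H} (hμ : μ ∉ O.hatCone) : O.wtPiece μ = ⊥ := by
  rw [wtPiece, weightPiece, Submodule.span_eq_bot]
  rintro _ ⟨l, hl, hsum, rfl⟩
  have := O.neg_sum_mem_hatCone l fun b hb => (hl b hb).1
  rw [hsum, neg_neg] at this
  exact absurd this hμ

lemma eq_nil_of_sum_eq_zero (l : List (Weight ℂ H L × O.nHatNeg))
    (hl : ∀ b ∈ l, -b.1 ∈ O.hatPos) (hsum : (l.map fun b => b.1.toLinear).sum = 0) : l = [] := by
  by_contra hne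
  refine O.sum_ne_zero (l.map fun b => -b.1) (fun α hα => ?_) (by simpa using hne) ?_
  · obtain ⟨b, hb, rfl⟩ := List.mem_map.mp hα
    exact (hl b hb).1
  · have h : ∀ l : List (Weight ℂ H L × O.nHatNeg),
        ((l.map fun b => -b.1).map fun α : Weight ℂ H L => α.toLinear).sum =
          -(l.map fun b => b.1.toLinear).sum := by
      intro l
      induction l with
      | nil => simp
      | cons b l ih =>
        simp only [List.map_cons, List.sum_cons, ih, Weight.toLinear_neg]
        abel
    rw [h, hsum, neg_zero]

lemma wtPiece_zero_le : O.wtPiece 0 ≤ Submodule.span ℂ {1} := by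
  refine Submodule.span_le.mpr ?_
  rintro _ ⟨l, hl, hsum, rfl⟩
  rw [neg_zero] at hsum
  rw [O.eq_nil_of_sum_eq_zero l (fun b hb => (hl b hb).1) hsum]
  exact Submodule.subset_span rfl

lemma counit_wtPiece {μ : Module.Dual ℂ H} (hμ : μ ≠ 0) {a : U O.nHatNeg}
    (ha : a ∈ O.wtPiece μ) : counit O.nHatNeg a = 0 := by
  refine (Submodule.span_le.mpr ?_ :
    O.wtPiece μ ≤ LinearMap.ker (counit O.nHatNeg).toLinearMap) ha
  rintro _ ⟨l, hl, hsum, rfl⟩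
  rcases l with _ | ⟨b, l⟩
  · exact absurd (by simpa using hsum) hμ
  · change counit O.nHatNeg _ = 0
    rw [List.map_cons, List.prod_cons, map_mul, counit_iota, zero_mul]

lemma wtPiece_le_gradedPiece {μ : Module.Dual ℂ H} {d : ℤ} (hd : O.HasDegree μ d) :
    O.wtPiece μ ≤ O.gradedPiece O.nHatNeg (-d) := by
  refine Submodule.span_mono ?_
  rintro _ ⟨l, hl, hsum, rfl⟩
  exact ⟨l, fun b hb => (hl b hb).2, by rw [hsum]; exact hd.neg, rfl⟩

lemma mem_stabSub_or {χ : Weight ℂ H L} (hlam : sharp lam ∈ H) (hχ : -χ ∉ O.hatPos) {x : L}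
    (hx : x ∈ rootSpace H χ) : x ∈ stabSub lam ⊔ O.nHatPos.toSubmodule := by
  rcases O.trichotomy χ with h | h | h
  · exact Submodule.mem_sup_right (rootSpace_le_rootSubalgebra h hx)
  · exact absurd h hχ
  · exact Submodule.mem_sup_left (mem_stabSub_of_form_eq_zero hlam h hx)

variable {O} in
/-- Root vectors shift the weights of the generalized Verma module by their root. -/
lemma act_mem_wtPiece (T : Triangular lam O.nHatPos O.nHatNeg) (hlam : sharp lam ∈ H)
    {χ : Weight ℂ H L} {x : L} (hx : x ∈ rootSpace H χ)
    {μ : Module.Dual ℂ H} {a : U O.nHatNeg} (ha : a ∈ O.wtPiece μ) :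
    T.act (iota L x) a ∈ O.wtPiece (μ - χ.toLinear) := by
  -- induction on the number of factors, simultaneously for all root vectors
  suffices h : ∀ (l : List (Weight ℂ H L × O.nHatNeg)),
      (∀ b ∈ l, -b.1 ∈ O.hatPos ∧ (b.2 : L) ∈ rootSpace H b.1) →
      ∀ (f : H → ℂ) (x : L), x ∈ rootSpace H f → ∀ ν : Module.Dual ℂ H, (∀ h, ν h = f h) →
      T.act (iota L x) (l.map fun b => iota O.nHatNeg b.2).prod ∈
        O.wtPiece (-(l.map fun b => b.1.toLinear).sum - ν) by
    refine (Submodule.span_le.mpr ?_ :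
      O.wtPiece μ ≤ (O.wtPiece (μ - χ.toLinear)).comap (T.act (iota L x))) ha
    rintro _ ⟨l, hl, hsum, rfl⟩
    have := h l hl χ x hx χ.toLinear fun _ => rfl
    rwa [hsum, neg_neg] at this
  intro l
  induction l with
  | nil =>
    intro _ f x hx ν hν
    by_cases hf : rootSpace H f = ⊥
    · rw [hf, LieSubmodule.mem_bot] at hx
      rw [hx]
      simp
    obtain ⟨χ, rfl⟩ : ∃ χ : Weight ℂ H L, f = χ := ⟨⟨f, hf⟩, rfl⟩
    obtain rfl : ν = χ.toLinear := LinearMap.ext hν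
    by_cases hχ : -χ ∈ O.hatPos
    · have hxm : x ∈ O.nHatNeg := rootSpace_le_rootSubalgebra (s := {α | -α ∈ O.hatPos}) hχ hx
      have := O.iota_mul_mem_wtPiece hχ (x := ⟨x, hxm⟩) hx O.one_mem_wtPiece
      rw [← T.actMap_mem, ← T.act_iota] at this
      simpa using this
    · simp only [List.map_nil, List.prod_nil, List.sum_nil]
      rw [T.act_iota_one_of_mem (O.mem_stabSub_or hlam hχ hx)]
      by_cases h0 : χ.IsZero
      · have h1 : χ.toLinear = 0 := by simpa using h0
        rw [h1]
        simpa using Submodule.smul_mem _ _ O.one_mem_wtPiece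
      · rw [apply_eq_zero_of_mem_rootSpace hlam h0 hx, zero_smul]
        exact zero_mem _
  | cons b l ih =>
    intro hl f x hx ν hν
    obtain ⟨hb, hbx⟩ := hl b List.mem_cons_self
    have hl' : ∀ c ∈ l, -c.1 ∈ O.hatPos ∧ (c.2 : L) ∈ rootSpace H c.1 :=
      fun c hc => hl c (List.mem_cons_of_mem _ hc)
    simp only [List.map_cons, List.prod_cons, List.sum_cons]
    rw [T.act_iota, T.actMap_mul,
      ← T.act_iota, ← T.act_iota]
    refine AddMemClass.add_mem ?_ ?_
    · have := O.iota_mul_mem_wtPiece hb hbx (ih hl' f x hx ν hν)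
      convert this using 2
      abel
    · have := ih hl' _ _ (lie_mem_genWeightSpace_of_mem_genWeightSpace hx hbx)
        (ν + b.1.toLinear) (fun h => by simp [hν])
      convert this using 2
      abel

variable {O} in
/-- The Cartan subalgebra acts on the part of weight `-μ` by `lam - μ`. -/
lemma act_cartan (T : Triangular lam O.nHatPos O.nHatNeg) (hlam : sharp lam ∈ H) (h : H)
    {μ : Module.Dual ℂ H} {a : U O.nHatNeg} (ha : a ∈ O.wtPiece μ) :
    T.act (iota L (h : L)) a = (restr H lam - μ) h • a := by
  have hh : (h : L) ∈ stabSub lam := by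
    rw [mem_stabSub_iff_lie_sharp]
    have := lie_eq_smul_of_mem_rootSpace
      (toLieSubmodule_le_rootSpace_zero ℂ L H h.2 : (h : L) ∈ rootSpace H 0) ⟨_, hlam⟩
    simpa using this
  refine sub_eq_zero.mp ((Submodule.span_le.mpr ?_ : O.wtPiece μ ≤ LinearMap.ker
    (T.act (iota L (h : L)) - (restr H lam - μ) h • LinearMap.id)) ha)
  rintro _ ⟨l, hl, hsum, rfl⟩
  obtain rfl := neg_eq_iff_eq_neg.mpr hsum
  refine sub_eq_zero.mpr ?_
  rw [LinearMap.smul_apply, LinearMap.id_apply, sub_neg_eq_add]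
  clear hsum ha
  induction l with
  | nil =>
    simp only [List.map_nil, List.prod_nil, List.sum_nil]
    rw [T.act_iota_one_of_mem (Submodule.mem_sup_left hh)]
    rw [add_zero]
    rfl
  | cons b l ih =>
    simp only [List.map_cons, List.prod_cons, List.sum_cons]
    rw [T.act_iota, T.actMap_mul,
      ← T.act_iota, ih fun c hc => hl c (List.mem_cons_of_mem _ hc)]
    have hlie : ⁅(h : L), (b.2 : L)⁆ = ((b.1 h • b.2 : O.nHatNeg) : L) :=
      lie_eq_smul_of_mem_rootSpace (hl b List.mem_cons_self).2 h
    rw [hlie, T.actMap_mem, map_smul, smul_mul_assoc, mul_smul_comm, ← add_smul]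
    congr 1
    simp
    ring

end InvariantOrdering

end Weights

section Casimir

variable {L : Type*} [LieRing L] [LieAlgebra ℂ L] [FiniteDimensional ℂ L] [IsSemisimple ℂ L]
variable {H : LieSubalgebra ℂ L} [H.IsCartanSubalgebra] {lam : Module.Dual ℂ L}

/-! ### The Casimir element -/

lemma killing_comm (x y : L) : killingForm ℂ L x y = killingForm ℂ L y x := by
  rw [killingForm, LieModule.traceForm_comm]

lemma dual_expansion {I : Type*} [Fintype I] {e f : I → L}
    (h : ∀ x, x = ∑ i, killingForm ℂ L x (f i) • e i) (y : L) :
    y = ∑ i, killingForm ℂ L y (e i) • f i := by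
  rw [← sub_eq_zero]
  refine (IsKilling.killingForm_nondegenerate ℂ L).2 _ fun x => ?_
  conv_lhs => rw [map_sub, map_sum]; enter [1]; rw [h x]
  rw [map_sum, LinearMap.sum_apply, ← Finset.sum_sub_distrib]
  refine Finset.sum_eq_zero fun i _ => ?_
  rw [map_smul, map_smul, LinearMap.smul_apply, smul_eq_mul, smul_eq_mul,
    killing_comm y (e i)]
  ring

/-- The Casimir element is central: the expansions of the brackets with the two dual families
have opposite coefficients, by the invariance of the Killing form. -/
lemma casimir_comm {I : Type*} [Fintype I] {e f : I → L}
    (h : ∀ x, x = ∑ i, killingForm ℂ L x (f i) • e i) (a : U L) :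
    a * ∑ i, iota L (e i) * iota L (f i) = (∑ i, iota L (e i) * iota L (f i)) * a := by
  have h' := dual_expansion h
  set Ω := ∑ i, iota L (e i) * iota L (f i) with hΩ
  refine U_induction (LinearMap.eqLocus (LinearMap.mulRight ℂ Ω) (LinearMap.mulLeft ℂ Ω))
    (by simp) (fun x a ha => ?_) a
  have ha : a * Ω = Ω * a := ha
  have hx : iota L x * Ω - Ω * iota L x = 0 := by
    have h1 : ∀ i, iota L ⁅x, e i⁆ * iota L (f i) =
        ∑ j, killingForm ℂ L ⁅x, e i⁆ (f j) • (iota L (e j) * iota L (f i)) := by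
      intro i
      conv_lhs => rw [h ⁅x, e i⁆]
      simp only [map_sum, map_smul, Finset.sum_mul, smul_mul_assoc]
    have h2 : ∀ i, iota L (e i) * iota L ⁅x, f i⁆ =
        ∑ j, killingForm ℂ L ⁅x, f i⁆ (e j) • (iota L (e i) * iota L (f j)) := by
      intro i
      conv_lhs => rw [h' ⁅x, f i⁆]
      simp only [map_sum, map_smul, Finset.mul_sum, mul_smul_comm]
    have h3 : iota L x * Ω - Ω * iota L x =
        ∑ i, iota L ⁅x, e i⁆ * iota L (f i) + ∑ i, iota L (e i) * iota L ⁅x, f i⁆ := by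
      rw [hΩ, Finset.mul_sum, Finset.sum_mul, ← Finset.sum_sub_distrib, ← Finset.sum_add_distrib]
      refine Finset.sum_congr rfl fun i _ => ?_
      rw [iota_lie, iota_lie]
      noncomm_ring
    rw [h3]
    simp only [h1, h2]
    rw [Finset.sum_comm, ← Finset.sum_add_distrib]
    refine Finset.sum_eq_zero fun i _ => ?_
    rw [← Finset.sum_add_distrib]
    refine Finset.sum_eq_zero fun j _ => ?_
    rw [← add_smul]
    have : killingForm ℂ L ⁅x, e j⁆ (f i) + killingForm ℂ L ⁅x, f i⁆ (e j) = 0 := by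
      rw [killingForm, LieModule.traceForm_apply_lie_apply', ← killingForm, killing_comm (e j)]
      ring
    rw [this, zero_smul]
  change iota L x * a * Ω = Ω * (iota L x * a)
  rw [mul_assoc, ha, ← mul_assoc, ← mul_assoc, sub_eq_zero.mp hx]

variable (H) in
/-- A basis of the Cartan subalgebra. -/
def cartanBasis : Module.Basis (Fin (Module.finrank ℂ H)) ℂ H := Module.finBasis ℂ H

variable (H) in
/-- The dual basis of the Cartan subalgebra with respect to the Killing form. -/
def cartanDual (j : Fin (Module.finrank ℂ H)) : H :=
  (cartanEquivDual H).symm ((cartanBasis H).coord j)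

lemma killing_cartanDual (x : H) (j : Fin (Module.finrank ℂ H)) :
    killingForm ℂ L x (cartanDual H j) = (cartanBasis H).coord j x := by
  have h : cartanEquivDual H (cartanDual H j) x = (cartanBasis H).coord j x := by
    rw [cartanDual, LinearEquiv.apply_symm_apply]
  rw [← h, killing_comm]
  rfl

lemma sum_killing_cartanDual (x : H) :
    ∑ j, killingForm ℂ L x (cartanDual H j) • cartanBasis H j = x := by
  simp only [killing_cartanDual]
  exact (cartanBasis H).sum_repr x

lemma form_self_eq_sum (ν : Module.Dual ℂ H) :
    form H ν ν = ∑ j, ν (cartanBasis H j) * ν (cartanDual H j) := by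
  rw [form_eq]
  conv_lhs => rw [← sum_killing_cartanDual ((cartanEquivDual H).symm ν)]
  rw [map_sum]
  refine Finset.sum_congr rfl fun j _ => ?_
  have : killingForm ℂ L ((cartanEquivDual H).symm ν : H) (cartanDual H j) = ν (cartanDual H j) := by
    conv_rhs => rw [← LinearEquiv.apply_symm_apply (cartanEquivDual H) ν]
    rfl
  rw [map_smul, this, smul_eq_mul, mul_comm]

namespace InvariantOrdering

variable {O : InvariantOrdering H lam} (R : O.RootVectors)

lemma killing_eq_zero {α β : Weight ℂ H L} {x y : L} (hx : x ∈ rootSpace H α)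
    (hy : y ∈ rootSpace H β) (hne : α ≠ -β) : killingForm ℂ L x y = 0 := by
  refine killingForm_apply_eq_zero_of_mem_rootSpace_of_add_ne_zero ℂ L H hx hy fun h => hne ?_
  ext h'
  have := congrFun h h'
  simp only [Pi.add_apply, Pi.zero_apply] at this
  simp only [Weight.coe_neg, Pi.neg_apply]
  linear_combination this

lemma eq_smul_of_mem_rootSpace {α : Weight ℂ H L} (hα : α.IsNonZero) {x y z : L}
    (hx : x ∈ rootSpace H α) (hy : y ∈ rootSpace H α) (hyz : killingForm ℂ L y z = 1) :
    x = killingForm ℂ L x z • y := by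
  have hy0 : (⟨y, hy⟩ : rootSpace H α) ≠ 0 := by
    intro h
    have : y = 0 := congrArg Subtype.val h
    rw [this] at hyz
    simp at hyz
  obtain ⟨c, hc⟩ := (finrank_eq_one_iff_of_nonzero' _ hy0).mp (finrank_rootSpace_eq_one α hα) ⟨x, hx⟩
  have hc' : c • y = x := congrArg Subtype.val hc
  rw [← hc', map_smul, LinearMap.smul_apply, hyz, smul_eq_mul, mul_one]

/-- The root vectors together with a basis of the Cartan subalgebra. -/
def RootVectors.basisFamily (R : O.RootVectors) :
    {α // α ∈ O.pos} ⊕ {α // α ∈ O.pos} ⊕ Fin (Module.finrank ℂ H) → L :=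
  Sum.elim R.X (Sum.elim R.Y fun j => cartanBasis H j)

/-- The dual family with respect to the Killing form. -/
def RootVectors.dualFamily (R : O.RootVectors) :
    {α // α ∈ O.pos} ⊕ {α // α ∈ O.pos} ⊕ Fin (Module.finrank ℂ H) → L :=
  Sum.elim R.Y (Sum.elim R.X fun j => cartanDual H j)

lemma mem_rootSpace_zero (h : H) [Nontrivial L] : (h : L) ∈ rootSpace H (0 : Weight ℂ H L) :=
  toLieSubmodule_le_rootSpace_zero ℂ L H h.2

lemma RootVectors.expansion (x : L) :
    x = ∑ i, killingForm ℂ L x (R.dualFamily i) • R.basisFamily i := by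
  rcases subsingleton_or_nontrivial L with _ | _
  · exact Subsingleton.elim _ _
  have hx : x ∈ ⨆ χ : Weight ℂ H L, (rootSpace H χ).toSubmodule := by
    rw [← LieSubmodule.iSup_toSubmodule, iSup_genWeightSpace_eq_top' ℂ H L]
    trivial
  induction hx using Submodule.iSup_induction' with
  | zero => simp
  | add x y _ _ hx hy =>
    conv_lhs => rw [hx, hy]
    simp only [map_add, LinearMap.add_apply, add_smul, Finset.sum_add_distrib]
  | mem χ x hx =>
    rw [Fintype.sum_sum_type, Fintype.sum_sum_type]
    simp only [basisFamily, dualFamily, Sum.elim_inl, Sum.elim_inr]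
    have hcart : χ.IsNonZero → ∑ j, killingForm ℂ L x (cartanDual H j : H) •
        (cartanBasis H j : L) = 0 := by
      intro hχ
      refine Finset.sum_eq_zero fun j _ => ?_
      rw [killing_eq_zero hx (mem_rootSpace_zero _), zero_smul]
      intro h
      rw [h] at hχ
      exact hχ Weight.isZero_zero.neg
    have hY : ∀ a, a.1 ≠ χ → killingForm ℂ L x (R.Y a) = 0 := by
      intro a ha
      refine killing_eq_zero hx (R.Y_mem a) fun h => ha ?_
      rw [h, neg_neg]
    have hX : ∀ a, -a.1 ≠ χ → killingForm ℂ L x (R.X a) = 0 :=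
      fun a ha => killing_eq_zero hx (R.X_mem a) fun h => ha h.symm
    by_cases hχ : χ.IsZero
    · have hχ' : ∀ a : {α // α ∈ O.pos}, a.1 ≠ χ := by
        rintro a rfl
        exact O.isNonZero_of_mem_pos a.2 hχ
      have hχ'' : ∀ a : {α // α ∈ O.pos}, -a.1 ≠ χ := by
        rintro a rfl
        exact (O.isNonZero_of_mem_pos a.2).neg hχ
      rw [Finset.sum_eq_zero fun a _ => by rw [hY a (hχ' a), zero_smul],
        Finset.sum_eq_zero fun a _ => by rw [hX a (hχ'' a), zero_smul], zero_add, zero_add]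
      have hxH : x ∈ H := by
        have h0 : (χ : H → ℂ) = 0 := hχ
        rw [h0, rootSpace_zero_eq] at hx
        exact hx
      have := congrArg (fun h : H => (h : L)) (sum_killing_cartanDual ⟨x, hxH⟩)
      simpa using this.symm
    · have hχr : χ ∈ H.root := by
        suffices χ.IsNonZero by simpa using this
        exact hχ
      rw [hcart hχ, add_zero]
      rcases O.mem_or_neg_mem χ hχr with h | h
      · have hχ'' : ∀ a : {α // α ∈ O.pos}, -a.1 ≠ χ := by
          rintro a rfl
          exact O.neg_notMem _ a.2 h
        rw [Finset.sum_eq_single_of_mem ⟨χ, h⟩ (Finset.mem_univ _)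
            fun a _ ha => by rw [hY a fun h => ha (Subtype.ext h), zero_smul],
          Finset.sum_eq_zero fun a _ => by rw [hX a (hχ'' a), zero_smul], add_zero]
        exact eq_smul_of_mem_rootSpace hχ hx (R.X_mem ⟨χ, h⟩) (R.killing _)
      · have hχ' : ∀ a : {α // α ∈ O.pos}, a.1 ≠ χ := by
          rintro a rfl
          exact O.neg_notMem _ a.2 h
        rw [Finset.sum_eq_zero fun a _ => by rw [hY a (hχ' a), zero_smul], zero_add,
          Finset.sum_eq_single_of_mem ⟨-χ, h⟩ (Finset.mem_univ _)
            fun a _ ha => by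
              rw [hX a fun h => ha (Subtype.ext (neg_eq_iff_eq_neg.mp h)), zero_smul]]
        have hYm := R.Y_mem ⟨-χ, h⟩
        rw [neg_neg] at hYm
        exact eq_smul_of_mem_rootSpace hχ hx hYm ((killing_comm _ _).trans (R.killing _))

/-- The Casimir element, with positive root vectors moved to the right. -/
lemma RootVectors.casimir_eq :
    ∑ i, iota L (R.basisFamily i) * iota L (R.dualFamily i) =
      (2 : ℂ) • ∑ a, iota L (R.Y a) * iota L (R.X a) +
        ∑ a : {α // α ∈ O.pos}, iota L (((cartanEquivDual H).symm a.1.toLinear : H) : L) +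
        ∑ j, iota L (cartanBasis H j : L) * iota L (cartanDual H j : L) := by
  rw [Fintype.sum_sum_type, Fintype.sum_sum_type]
  simp only [basisFamily, dualFamily, Sum.elim_inl, Sum.elim_inr]
  have h : ∀ a : {α // α ∈ O.pos}, iota L (R.X a) * iota L (R.Y a) =
      iota L (R.Y a) * iota L (R.X a) +
        iota L (((cartanEquivDual H).symm a.1.toLinear : H) : L) := by
    intro a
    have hY : R.Y a ∈ rootSpace H (-(a.1 : H → ℂ)) := by
      rw [← Weight.coe_neg]; exact R.Y_mem a
    have h1 := lie_eq_killingForm_smul_of_mem_rootSpace_of_mem_rootSpace_neg (R.X_mem a) hY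
    rw [R.killing, one_smul] at h1
    rw [← h1, iota_lie]
    abel
  simp only [h, Finset.sum_add_distrib, two_smul]
  abel

/-- The key identity of the construction: on the part of weight `-μ` of the generalized Verma module,
the operator `∑ Y X` is the scalar `-p(μ)`. This compares the value of the Casimir element with its
value on the highest weight vector. -/
lemma RootVectors.sum_act (T : Triangular lam O.nHatPos O.nHatNeg) (hlam : sharp lam ∈ H)
    {μ : Module.Dual ℂ H} {v : U O.nHatNeg} (hv : v ∈ O.wtPiece μ) :
    ∑ a, T.act (iota L (R.Y a)) (T.act (iota L (R.X a)) v) = -O.p μ • v := by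
  set Ω := ∑ i, iota L (R.basisFamily i) * iota L (R.dualFamily i) with hΩ
  have hact : ∀ {μ : Module.Dual ℂ H} {v : U O.nHatNeg}, v ∈ O.wtPiece μ → T.act Ω v =
      (2 : ℂ) • ∑ a, T.act (iota L (R.Y a)) (T.act (iota L (R.X a)) v) +
        (2 * form H O.rho (restr H lam - μ) +
          form H (restr H lam - μ) (restr H lam - μ)) • v := by
    intro μ v hv
    rw [hΩ, R.casimir_eq]
    simp only [map_add, map_smul, map_sum, map_mul, LinearMap.add_apply, LinearMap.smul_apply,
      LinearMap.sum_apply, Module.End.mul_apply, act_cartan T hlam _ hv]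
    rw [add_assoc]
    congr 1
    rw [form_self_eq_sum, rho, form_smul_left, form_sum_left, add_smul, Finset.sum_smul]
    congr 1
    · rw [← Finset.sum_smul]
      congr 1
      rw [← mul_assoc, mul_one_div_cancel (two_ne_zero), one_mul, ← Finset.sum_coe_sort O.pos]
      refine Finset.sum_congr rfl fun a _ => ?_
      rw [form_comm, form_eq]
    · refine Finset.sum_congr rfl fun j _ => ?_
      rw [smul_smul, mul_comm]
  have hX1 : ∀ a, T.act (iota L (R.X a)) 1 = 0 := by
    intro a
    rw [T.act_iota_one_of_mem (O.mem_stabSub_or hlam (fun h => O.neg_notMem _ a.2 h.1) (R.X_mem a)),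
      apply_eq_zero_of_mem_rootSpace hlam (O.isNonZero_of_mem_pos a.2) (R.X_mem a), zero_smul]
  have h0 := hact O.one_mem_wtPiece
  simp only [hX1, map_zero, Finset.sum_const_zero, smul_zero, zero_add, sub_zero] at h0
  have h1 : T.act Ω v = (2 * form H O.rho (restr H lam) +
      form H (restr H lam) (restr H lam)) • v := by
    have h2 : T.act Ω v = T.act (Ω * incl O.nHatNeg v) 1 := by
      rw [map_mul, Module.End.mul_apply, T.act_incl_one]
    rw [h2, ← casimir_comm R.expansion, map_mul, Module.End.mul_apply, h0, map_smul,
      T.act_incl_one]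
  have h3 := hact hv
  rw [h1] at h3
  have h4 : (2 : ℂ) • ∑ a, T.act (iota L (R.Y a)) (T.act (iota L (R.X a)) v) =
      (2 : ℂ) • (-O.p μ • v) := by
    rw [← sub_eq_iff_eq_add, ← sub_smul] at h3
    rw [← h3, smul_smul]
    congr 1
    simp only [form_sub_left, form_sub_right, p, form_comm μ (restr H lam)]
    ring
  exact smul_right_injective _ (two_ne_zero (α := ℂ)) h4

end InvariantOrdering

end Casimir

section Expansion

variable {L : Type*} [LieRing L] [LieAlgebra ℂ L] [FiniteDimensional ℂ L] [IsSemisimple ℂ L]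
variable {H : LieSubalgebra ℂ L} [H.IsCartanSubalgebra] {lam : Module.Dual ℂ L}

namespace InvariantOrdering

variable {O : InvariantOrdering H lam}

/-! ### The projections and the pairing in terms of the action -/

lemma projNeg_eq (T : Triangular lam O.nHatPos O.nHatNeg) (v : U O.nNeg) :
    O.projNeg v = T.act (incl O.nNeg v) 1 := by
  have hb := T.bijective_vermaMk
  apply hb.1
  exact (apply_linInv_of_bijective hb _).trans
    ((Submodule.Quotient.eq _).mpr (T.sub_mem_leftIdeal _))

lemma shapovalov_eq (T : Triangular lam O.nHatPos O.nHatNeg) (u : U O.nHatPos) (v : U O.nHatNeg) :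
    O.shapovalov u v = counit O.nHatNeg (T.act (antipode L (incl O.nHatPos u)) v) := by
  rw [shapovalov, T.pairing_eq, T.hc_apply, map_mul, Module.End.mul_apply, T.act_incl_one]

lemma shapovalov_projPos (T : Triangular lam O.nHatPos O.nHatNeg) (u : U O.nPos)
    (v : U O.nHatNeg) :
    O.shapovalov (O.projPos u) v = counit O.nHatNeg (T.act (antipode L (incl O.nPos u)) v) := by
  have hb := T.bijective_rightVermaMk
  set u' := linInv (rightVermaMk lam O.nHatNeg ∘ₗ (incl O.nHatPos).toLinearMap)
    (rightVermaMk lam O.nHatNeg (incl O.nPos (antipode O.nPos u))) with hu'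
  have h1 : O.projPos u = antipode O.nHatPos u' := rfl
  have h2 : rightVermaMk lam O.nHatNeg (incl O.nHatPos u') =
      rightVermaMk lam O.nHatNeg (incl O.nPos (antipode O.nPos u)) :=
    apply_linInv_of_bijective hb _
  rw [h1, shapovalov, T.pairing_eq, ← incl_antipode, antipode_antipode, ← T.hcPairing_mk, h2,
    T.hcPairing_mk, incl_antipode, T.hc_apply, map_mul, Module.End.mul_apply, T.act_incl_one]

/-! ### The expansion over words -/

/-- The product of the `X_α` over the letters of a word, in `U L`. -/
def RootVectors.prodX (R : O.RootVectors) (w : O.Word) : U L :=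
  (w.map fun a => iota L (R.X a)).prod

/-- The product of the `Y_α` over the letters of a word, in `U L`. -/
def RootVectors.prodY (R : O.RootVectors) (w : O.Word) : U L :=
  (w.map fun a => iota L (R.Y a)).prod

variable (R : O.RootVectors)

lemma incl_wordX (w : O.Word) : incl O.nPos (R.wordX w) = R.prodX w := by
  rw [RootVectors.wordX, map_list_prod, List.map_map, RootVectors.prodX]
  congr 1
  refine List.map_congr_left fun a _ => ?_
  exact incl_iota _ _

lemma incl_wordY (w : O.Word) : incl O.nNeg (R.wordY w) = R.prodY w := by
  rw [RootVectors.wordY, map_list_prod, List.map_map, RootVectors.prodY]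
  congr 1
  refine List.map_congr_left fun a _ => ?_
  exact incl_iota _ _

lemma act_prodY_cons (T : Triangular lam O.nHatPos O.nHatNeg) (a : {α // α ∈ O.pos}) (w : O.Word)
    (v : U O.nHatNeg) :
    T.act (R.prodY (a :: w)) v = T.act (iota L (R.Y a)) (T.act (R.prodY w) v) := by
  rw [RootVectors.prodY, List.map_cons, List.prod_cons, map_mul, Module.End.mul_apply]
  rfl

lemma act_prodX_cons (T : Triangular lam O.nHatPos O.nHatNeg) (a : {α // α ∈ O.pos}) (w : O.Word)
    (v : U O.nHatNeg) :
    T.act (antipode L (R.prodX (a :: w))) v =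
      -T.act (antipode L (R.prodX w)) (T.act (iota L (R.X a)) v) := by
  rw [RootVectors.prodX, List.map_cons, List.prod_cons, antipode_mul, antipode_iota, map_mul,
    Module.End.mul_apply, map_neg, LinearMap.neg_apply, map_neg]
  rfl

lemma act_prodX_mem (T : Triangular lam O.nHatPos O.nHatNeg) (hlam : sharp lam ∈ H) (w : O.Word)
    {μ : Module.Dual ℂ H} {v : U O.nHatNeg} (hv : v ∈ O.wtPiece μ) :
    T.act (antipode L (R.prodX w)) v ∈ O.wtPiece (μ - O.wt w) := by
  induction w generalizing μ v with
  | nil => simpa [RootVectors.prodX] using hv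
  | cons a w ih =>
    rw [act_prodX_cons, O.wt_cons, ← sub_sub]
    exact neg_mem (ih (act_mem_wtPiece T hlam (R.X_mem a) hv))

lemma act_prodY_one_mem (T : Triangular lam O.nHatPos O.nHatNeg) (hlam : sharp lam ∈ H)
    (w : O.Word) : T.act (R.prodY w) 1 ∈ O.wtPiece (O.wt w) := by
  induction w with
  | nil => simpa [RootVectors.prodY] using O.one_mem_wtPiece
  | cons a w ih =>
    rw [act_prodY_cons, O.wt_cons]
    convert act_mem_wtPiece T hlam (R.Y_mem a) ih using 2
    rw [Weight.toLinear_neg]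
    abel

variable (O) in
open Classical in
/-- The coefficient of the term of a word `w` in the canonical element; it is `0` for words that do
not belong to `W̃`. -/
def coef (w : O.Word) : ℂ :=
  if w ∈ O.wordsTilde then ∏ i ∈ Finset.range w.length, (O.p (O.wt (w.drop i)))⁻¹ else 0

lemma coef_of_mem {w : O.Word} (hw : w ∈ O.wordsTilde) :
    O.coef w = ∏ i ∈ Finset.range w.length, (O.p (O.wt (w.drop i)))⁻¹ := if_pos hw

lemma coef_of_notMem {w : O.Word} (hw : w ∉ O.wordsTilde) : O.coef w = 0 := if_neg hw

lemma coef_nil : O.coef [] = 1 := by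
  rw [coef_of_mem O.nil_mem_wordsTilde]
  rfl

lemma coef_cons {a : {α // α ∈ O.pos}} {w : O.Word} (h : O.wt (a :: w) ∈ O.hatCone) :
    O.coef (a :: w) = (O.p (O.wt (a :: w)))⁻¹ * O.coef w := by
  by_cases hw : w ∈ O.wordsTilde
  · rw [coef_of_mem hw, coef_of_mem (O.cons_mem_wordsTilde_iff.mpr ⟨h, hw⟩), List.length_cons,
      Finset.prod_range_succ', mul_comm]
    rfl
  · rw [coef_of_notMem hw, coef_of_notMem fun hc => hw (O.cons_mem_wordsTilde_iff.mp hc).2,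
      mul_zero]

variable (O) in
/-- The finite set of the words of weight `μ`. -/
def wordsOfWeight (μ : Module.Dual ℂ H) : Finset O.Word := (O.finite_wt_eq μ).toFinset

lemma mem_wordsOfWeight {μ : Module.Dual ℂ H} {w : O.Word} :
    w ∈ O.wordsOfWeight μ ↔ O.wt w = μ := by
  simp [wordsOfWeight]

lemma sum_wordsOfWeight {M : Type*} [AddCommMonoid M] {μ : Module.Dual ℂ H} (hμ : μ ≠ 0)
    (g : O.Word → M) :
    ∑ w ∈ O.wordsOfWeight μ, g w =
      ∑ a : {α // α ∈ O.pos}, ∑ w ∈ O.wordsOfWeight (μ - a.1.toLinear), g (a :: w) := by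
  rw [Finset.sum_sigma']
  symm
  refine Finset.sum_bij (fun x _ => x.1 :: x.2) ?_ ?_ ?_ (fun _ _ => rfl)
  · rintro ⟨a, w⟩ h
    rw [Finset.mem_sigma, mem_wordsOfWeight] at h
    rw [mem_wordsOfWeight, O.wt_cons, h.2]
    abel
  · rintro ⟨a, w⟩ _ ⟨b, v⟩ _ h
    obtain ⟨rfl, rfl⟩ := List.cons.inj h
    rfl
  · intro w hw
    rw [mem_wordsOfWeight] at hw
    rcases w with _ | ⟨a, w⟩
    · exact absurd hw.symm hμ
    · refine ⟨⟨a, w⟩, ?_, rfl⟩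
      rw [Finset.mem_sigma, mem_wordsOfWeight, ← hw, O.wt_cons]
      simp

/-- A vector of weight `-μ ≠ 0` is `-p(μ)⁻¹ ∑ Y X v`, and the vectors `X v` have smaller weights, so
that iterating this identity expands `v` over the words of weight `μ`. -/
lemma expansion_of_mem_wtPiece (T : Triangular lam O.nHatPos O.nHatNeg) (hlam : sharp lam ∈ H)
    (hO : O.MemOmegaTilde) {μ : Module.Dual ℂ H} {v : U O.nHatNeg} (hv : v ∈ O.wtPiece μ) :
    ∑ w ∈ O.wordsOfWeight μ, (O.coef w * counit O.nHatNeg (T.act (antipode L (R.prodX w)) v)) •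
      T.act (R.prodY w) 1 = v := by
  -- induction on a bound for the length of the words of weight `μ`
  obtain ⟨N, hN⟩ : ∃ N, ∀ w, O.wt w = μ → w.length ≤ N :=
    ⟨(O.wordsOfWeight μ).sup List.length,
      fun w hw => Finset.le_sup (f := List.length) (mem_wordsOfWeight.mpr hw)⟩
  induction N generalizing μ v with
  | zero =>
    by_cases hc : μ ∈ O.hatCone
    · obtain ⟨w, -, hw⟩ := O.exists_word_of_mem_hatCone hc
      have hw0 : w = [] := List.eq_nil_of_length_eq_zero (Nat.le_zero.mp (hN w hw))
      obtain rfl : 0 = μ := by rw [← hw, hw0, O.wt_nil]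
      have hF : O.wordsOfWeight 0 = {[]} := by
        ext w
        rw [mem_wordsOfWeight, Finset.mem_singleton]
        exact ⟨fun h => List.eq_nil_of_length_eq_zero (Nat.le_zero.mp (hN w h)), fun h => by
          rw [h, O.wt_nil]⟩
      obtain ⟨c, rfl⟩ := Submodule.mem_span_singleton.mp (O.wtPiece_zero_le hv)
      rw [hF, Finset.sum_singleton, coef_nil]
      simp [RootVectors.prodX, RootVectors.prodY]
    · rw [O.wtPiece_eq_bot hc, Submodule.mem_bot] at hv
      simp [hv]
  | succ N ih =>
    by_cases hc : μ ∈ O.hatCone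
    · by_cases hμ : μ = 0
      · subst hμ
        refine ih hv fun w hw => ?_
        by_contra hlen
        exact O.wt_ne_zero (by rintro rfl; simp at hlen) hw
      have hp := hO μ hc hμ
      rw [sum_wordsOfWeight hμ]
      have hsum : ∀ a : {α // α ∈ O.pos}, ∑ w ∈ O.wordsOfWeight (μ - a.1.toLinear),
          (O.coef (a :: w) * counit O.nHatNeg (T.act (antipode L (R.prodX (a :: w))) v)) •
            T.act (R.prodY (a :: w)) 1 =
          -(O.p μ)⁻¹ • T.act (iota L (R.Y a)) (T.act (iota L (R.X a)) v) := by
        intro a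
        have h1 := ih (act_mem_wtPiece T hlam (R.X_mem a) hv) fun w hw => by
          have := hN (a :: w) (by rw [O.wt_cons, hw]; abel)
          simpa using this
        conv_rhs => rw [← h1]
        rw [map_sum, Finset.smul_sum]
        refine Finset.sum_congr rfl fun w hw => ?_
        have hwt : O.wt (a :: w) = μ := by
          rw [mem_wordsOfWeight] at hw
          rw [O.wt_cons, hw]
          abel
        rw [coef_cons (by rwa [hwt]), hwt, act_prodX_cons, act_prodY_cons, map_smul, smul_smul,
          map_neg]
        congr 1
        ring
      simp only [hsum]
      rw [← Finset.smul_sum, R.sum_act T hlam hv, smul_smul, neg_mul_neg, inv_mul_cancel₀ hp,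
        one_smul]
    · rw [O.wtPiece_eq_bot hc, Submodule.mem_bot] at hv
      simp [hv]

/-- The expansion `v = ∑ c_w ⟨π⁺ X_w, v⟩ π⁻ Y_w`, in which almost all terms vanish. -/
lemma expansion (hlam : sharp lam ∈ H) (hO : O.MemOmegaTilde) (v : U O.nHatNeg) :
    ∃ s : Finset O.Word, ∀ s', s ⊆ s' →
      ∑ w ∈ s', (O.coef w * O.shapovalov (O.projPos (R.wordX w)) v) •
        O.projNeg (R.wordY w) = v := by
  have T := O.triangular hlam
  simp only [projNeg_eq T, shapovalov_projPos T, incl_wordX, incl_wordY]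
  induction v using O.wtPiece_induction with
  | hadd a b ha hb =>
    classical
    obtain ⟨s, hs⟩ := ha
    obtain ⟨t, ht⟩ := hb
    refine ⟨s ∪ t, fun s' h => ?_⟩
    conv_rhs => rw [← hs s' (Finset.union_subset_left h), ← ht s' (Finset.union_subset_right h)]
    simp only [map_add, mul_add, add_smul, Finset.sum_add_distrib]
  | hzero => exact ⟨∅, fun s' _ => by simp⟩
  | h μ v hv =>
    refine ⟨O.wordsOfWeight μ, fun s' h => ?_⟩
    rw [← Finset.sum_subset h, expansion_of_mem_wtPiece R T hlam hO hv]
    intro w _ hw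
    rw [O.counit_wtPiece (sub_ne_zero.mpr fun h => hw (mem_wordsOfWeight.mpr h.symm))
      (act_prodX_mem R T hlam w hv), mul_zero, zero_smul]

include R in
lemma shapovalov_separatingRight (hlam : sharp lam ∈ H) (hO : O.MemOmegaTilde) :
    O.shapovalov.SeparatingRight := by
  intro v hv
  obtain ⟨s, hs⟩ := expansion R hlam hO v
  rw [← hs s le_rfl]
  simp [hv]

/-! ### The opposite ordering -/

lemma restr_neg (lam : Module.Dual ℂ L) : restr H (-lam) = -restr H lam := rfl

lemma sharp_neg (lam : Module.Dual ℂ L) : sharp (-lam) = -sharp lam := by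
  rw [sharp, map_neg, sharp]

variable (O) in
/-- The opposite ordering, in which the negative roots are positive. It is invariant with respect to
`-lam`. -/
def opp : InvariantOrdering H (-lam) where
  pos := O.pos.map (Equiv.neg _).toEmbedding
  pos_subset := by
    intro α hα
    obtain ⟨β, hβ, rfl⟩ := Finset.mem_map.mp hα
    have := O.pos_subset hβ
    simpa using this
  mem_or_neg_mem α hα := by
    have := O.mem_or_neg_mem α hα
    simpa [neg_eq_iff_eq_neg, or_comm] using this
  neg_notMem α hα := by
    obtain ⟨β, hβ, rfl⟩ := Finset.mem_map.mp hα
    have := O.neg_notMem β hβ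
    simpa [neg_eq_iff_eq_neg] using this
  add_mem α hα β hβ γ hγ h := by
    obtain ⟨α, hα₁, rfl⟩ := Finset.mem_map.mp hα
    obtain ⟨β, hβ₁, rfl⟩ := Finset.mem_map.mp hβ
    refine Finset.mem_map.mpr ⟨-γ, O.pos_closed α hα₁ β hβ₁ _ ?_, neg_neg γ⟩
    rw [Weight.toLinear_neg, h]
    change -((-α : Weight ℂ H L).toLinear + (-β : Weight ℂ H L).toLinear) = _
    rw [Weight.toLinear_neg, Weight.toLinear_neg]
    abel
  invariant α hα hα' β hβ hβ' γ hγ h := by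
    obtain ⟨α, hα₁, rfl⟩ := Finset.mem_map.mp hα
    change form H (-α : Weight ℂ H L).toLinear _ ≠ 0 at hα'
    rw [Weight.toLinear_neg, restr_neg, form_neg_left, form_neg_right, neg_neg] at hα'
    rw [restr_neg, form_neg_right, neg_eq_zero] at hβ'
    refine Finset.mem_map.mpr ⟨-γ, O.invariant α hα₁ hα' (-β) (by simpa using hβ) ?_ (-γ)
      (by simpa using hγ) ?_, neg_neg γ⟩
    · rw [Weight.toLinear_neg, form_neg_left, hβ', neg_zero]
    · rw [Weight.toLinear_neg, Weight.toLinear_neg, h]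
      change -((-α : Weight ℂ H L).toLinear + _) = _
      rw [Weight.toLinear_neg]
      abel

lemma mem_opp_pos {α : Weight ℂ H L} : α ∈ O.opp.pos ↔ -α ∈ O.pos := by
  change α ∈ O.pos.map (Equiv.neg _).toEmbedding ↔ _
  simp

lemma mem_opp_hatPos {α : Weight ℂ H L} : α ∈ O.opp.hatPos ↔ -α ∈ O.hatPos := by
  change α ∈ O.opp.pos ∧ form H α.toLinear (restr H (-lam)) ≠ 0 ↔
    -α ∈ O.pos ∧ form H (-α : Weight ℂ H L).toLinear (restr H lam) ≠ 0
  rw [mem_opp_pos, Weight.toLinear_neg, form_neg_left, restr_neg, form_neg_right]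

lemma opp_nHatPos : O.opp.nHatPos = O.nHatNeg := by
  rw [← LieSubalgebra.toSubmodule_inj]
  change (⨆ α ∈ O.opp.hatPos, _) = ⨆ α ∈ {α | -α ∈ O.hatPos}, _
  simp only [mem_opp_hatPos, Set.mem_ofPred_eq]

lemma opp_nHatNeg : O.opp.nHatNeg = O.nHatPos := by
  rw [← LieSubalgebra.toSubmodule_inj]
  change (⨆ α ∈ {α | -α ∈ O.opp.hatPos}, _) = ⨆ α ∈ O.hatPos, _
  simp only [mem_opp_hatPos, Set.mem_ofPred_eq, neg_neg]

lemma opp_rho : O.opp.rho = -O.rho := by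
  change (1 / 2 : ℂ) • ∑ α ∈ O.pos.map (Equiv.neg _).toEmbedding, α.toLinear = _
  rw [Finset.sum_map, rho, ← smul_neg, ← Finset.sum_neg_distrib]
  congr 1

lemma opp_p (μ : Module.Dual ℂ H) : O.opp.p μ = O.p (-μ) := by
  simp only [p, opp_rho, restr_neg, form_neg_left, form_neg_right]
  ring

lemma neg_mem_hatCone_of_opp {μ : Module.Dual ℂ H} (hμ : μ ∈ O.opp.hatCone) :
    -μ ∈ O.hatCone := by
  induction hμ using AddSubmonoid.closure_induction with
  | mem μ h =>
    obtain ⟨α, hα, rfl⟩ := h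
    exact AddSubmonoid.subset_closure ⟨-α, mem_opp_hatPos.mp hα, (Weight.toLinear_neg).symm⟩
  | zero => rw [neg_zero]; exact zero_mem _
  | add μ ν _ _ h1 h2 => rw [neg_add]; exact AddMemClass.add_mem h1 h2

lemma MemOmegaTilde.opp (hO : O.MemOmegaTilde) : O.opp.MemOmegaTilde := by
  intro μ hμ hne
  rw [opp_p]
  exact hO _ (neg_mem_hatCone_of_opp hμ) (neg_ne_zero.mpr hne)

/-- The root vectors for the opposite ordering. -/
def RootVectors.opp (R : O.RootVectors) : O.opp.RootVectors where
  X a := R.Y ⟨-a.1, mem_opp_pos.mp a.2⟩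
  Y a := R.X ⟨-a.1, mem_opp_pos.mp a.2⟩
  X_mem a := by
    have := R.Y_mem ⟨-a.1, mem_opp_pos.mp a.2⟩
    rwa [neg_neg] at this
  Y_mem a := R.X_mem ⟨-a.1, mem_opp_pos.mp a.2⟩
  killing a := (killing_comm _ _).trans (R.killing _)

include R in
/-- The pairing for the opposite ordering and `-lam` is the flip of the given one. -/
lemma shapovalov_separatingLeft (hlam : sharp lam ∈ H) (hO : O.MemOmegaTilde) :
    O.shapovalov.SeparatingLeft := by
  have h := shapovalov_separatingRight R.opp (by rw [sharp_neg]; exact neg_mem hlam) hO.opp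
  rw [shapovalov, opp_nHatPos, opp_nHatNeg] at h
  intro u hu
  refine h u fun v => ?_
  rw [(O.triangular hlam).pairing_symm]
  exact hu v

end InvariantOrdering

end Expansion

/-! ### Dual bases -/

section DualBases

variable {V W : Type*} [AddCommGroup V] [Module ℂ V] [AddCommGroup W] [Module ℂ W]

/-- Families that are biorthogonal for a pairing are linearly independent. -/
lemma linearIndependent_of_biorthogonal {I : Type*} [DecidableEq I] (B : V →ₗ[ℂ] W →ₗ[ℂ] ℂ)
    {u : I → V} {v : I → W} (h : ∀ i j, B (u i) (v j) = if i = j then 1 else 0) :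
    LinearIndependent ℂ u := by
  rw [linearIndependent_iff']
  intro s g hg i hi
  have := congrArg (fun x => B x (v i)) hg
  simpa [map_sum, LinearMap.sum_apply, h, hi] using this

/-- If a pairing is nondegenerate and orthogonal with respect to decompositions into weight spaces,
those on one side finite-dimensional, then dual bases exist: a basis of a weight space `C μ` has a dual
family in `A μ`, because `A μ` induces all linear functionals on `C μ`. -/
lemma exists_dual_bases {M : Type*} (B : V →ₗ[ℂ] W →ₗ[ℂ] ℂ) (hB : B.Nondegenerate)
    (A : M → Submodule ℂ V) (C : M → Submodule ℂ W) (hA : ⨆ μ, A μ = ⊤) (hC : ⨆ μ, C μ = ⊤)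
    (horth : ∀ μ ν, μ ≠ ν → ∀ a ∈ A μ, ∀ c ∈ C ν, B a c = 0)
    [∀ μ, FiniteDimensional ℂ (C μ)] (hcount : {μ | C μ ≠ ⊥}.Countable) :
    ∃ (I : Type) (u : Module.Basis I ℂ V) (v : Module.Basis I ℂ W),
      (∀ i, B (u i) (v i) = 1) ∧ ∀ i j, i ≠ j → B (u i) (v j) = 0 := by
  classical
  have hA_ind : ∀ {q : V → Prop}, (∀ μ, ∀ a ∈ A μ, q a) → q 0 →
      (∀ a b, q a → q b → q (a + b)) → ∀ a, q a := fun h h0 hadd a =>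
    Submodule.iSup_induction A (motive := _) (by rw [hA]; trivial) h h0 hadd
  -- every functional on `C μ` comes from `A μ`
  have hsurj : ∀ μ, ∀ f : Module.Dual ℂ (C μ), ∃ a ∈ A μ, ∀ c : C μ, B a c = f c := by
    intro μ
    let Φ : A μ →ₗ[ℂ] Module.Dual ℂ (C μ) := (B.domRestrict (A μ)).compl₂ (C μ).subtype
    have hΦ : Function.Surjective Φ := by
      rw [← LinearMap.flip_injective_iff₂, ← LinearMap.ker_eq_bot, LinearMap.ker_eq_bot']
      intro c hc
      refine Subtype.ext (hB.2 c fun a => ?_)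
      refine hA_ind (q := fun a => B a c = 0) (fun ν a ha => ?_) (by simp) (fun a b ha hb => ?_) a
      · by_cases h : ν = μ
        · subst h
          exact LinearMap.congr_fun hc ⟨a, ha⟩
        · exact horth ν μ h a ha c c.2
      · rw [map_add, LinearMap.add_apply, ha, hb, add_zero]
    intro f
    obtain ⟨a, ha⟩ := hΦ f
    exact ⟨a, a.2, fun c => LinearMap.congr_fun ha c⟩
  let Λ := {μ // C μ ≠ ⊥}
  have : Countable Λ := hcount
  let I := Σ μ : Λ, Fin (Module.finrank ℂ (C μ))
  have hinj : ∀ (μ : Λ) (i j : Fin (Module.finrank ℂ (C μ))),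
      ((⟨μ, i⟩ : I) = ⟨μ, j⟩) ↔ i = j := fun μ i j => by rw [Sigma.mk.injEq]; simp
  let b : ∀ μ, Module.Basis (Fin (Module.finrank ℂ (C μ))) ℂ (C μ) :=
    fun μ => Module.finBasis ℂ (C μ)
  let v : I → W := fun i => b i.1 i.2
  choose u hu hub using fun i : I => hsurj i.1 ((b i.1).coord i.2)
  have huv : ∀ i j, B (u i) (v j) = if i = j then 1 else 0 := by
    rintro ⟨μ, i⟩ ⟨ν, j⟩
    by_cases h : μ = ν
    · subst h
      rw [hub]
      simp [Finsupp.single_apply, hinj, eq_comm]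
    · rw [if_neg fun hc => h (congrArg Sigma.fst hc),
        horth μ ν (fun hc => h (Subtype.ext hc)) _ (hu ⟨μ, i⟩) _ (b ν j).2]
  have hv_span : ∀ c, c ∈ Submodule.span ℂ (Set.range v) := by
    have hle : ∀ μ : Λ, C μ ≤ Submodule.span ℂ (Set.range v) := by
      intro μ c hc
      have h := congrArg (C μ).subtype ((b μ).sum_repr ⟨c, hc⟩)
      rw [map_sum] at h
      change _ = c at h
      rw [← h]
      exact Submodule.sum_mem _ fun i _ => Submodule.smul_mem _ _
        (Submodule.subset_span ⟨⟨μ, i⟩, rfl⟩)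
    have := iSup_le hle
    rw [iSup_ne_bot_subtype, hC] at this
    exact fun c => this trivial
  have hsep : ∀ a, (∀ i, B a (v i) = 0) → a = 0 := by
    intro a ha
    refine hB.1 a fun c => ?_
    exact (Submodule.span_le.mpr (by rintro _ ⟨i, rfl⟩; exact ha i) :
      Submodule.span ℂ (Set.range v) ≤ LinearMap.ker (B a)) (hv_span c)
  have hu_span : ∀ a, a ∈ Submodule.span ℂ (Set.range u) := by
    refine hA_ind (fun μ a ha => ?_) (zero_mem _) fun _ _ => add_mem
    by_cases hμ : C μ = ⊥
    · rw [hsep a]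
      · exact zero_mem _
      · rintro ⟨ν, j⟩
        exact horth μ ν (by rintro rfl; exact ν.2 hμ) a ha _ (b ν j).2
    · have : a = ∑ j, B a (v ⟨⟨μ, hμ⟩, j⟩) • u ⟨⟨μ, hμ⟩, j⟩ := by
        refine sub_eq_zero.mp (hsep _ fun i => ?_)
        obtain ⟨ν, j⟩ := i
        by_cases h : (⟨μ, hμ⟩ : Λ) = ν
        · subst h
          simp [huv, hinj]
        · have h1 := horth μ ν (fun hc => h (Subtype.ext hc)) a ha _ (b ν j).2
          simp only [map_sub, LinearMap.sub_apply, map_sum, LinearMap.sum_apply, map_smul,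
            LinearMap.smul_apply, huv]
          rw [show B a (v ⟨ν, j⟩) = 0 from h1, Finset.sum_eq_zero, sub_zero]
          intro k _
          rw [if_neg fun hc => h (congrArg Sigma.fst hc), smul_zero]
      rw [this]
      exact Submodule.sum_mem _ fun i _ => Submodule.smul_mem _ _ (Submodule.subset_span ⟨_, rfl⟩)
  have hu_ind := linearIndependent_of_biorthogonal B huv
  have hv_ind := linearIndependent_of_biorthogonal B.flip (u := v) (v := u) fun i j => by
    simp [huv, eq_comm]
  -- the index type is countable, and may thus be replaced by a type in the lowest universe
  let e : I ≃ Shrink.{0} I := equivShrink.{0} I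
  refine ⟨Shrink.{0} I, (Module.Basis.mk hu_ind fun a _ => hu_span a).reindex e,
    (Module.Basis.mk hv_ind fun a _ => hv_span a).reindex e, fun i => ?_, fun i j hij => ?_⟩
  · simp [huv]
  · simp [huv, hij]

end DualBases

section Canonical

variable {L : Type*} [LieRing L] [LieAlgebra ℂ L] [FiniteDimensional ℂ L] [IsSemisimple ℂ L]
variable {H : LieSubalgebra ℂ L} [H.IsCartanSubalgebra] {lam : Module.Dual ℂ L}

namespace InvariantOrdering

variable {O : InvariantOrdering H lam}

lemma act_antipode_mem (T : Triangular lam O.nHatPos O.nHatNeg) (hlam : sharp lam ∈ H)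
    (l : List (Weight ℂ H L × O.nHatPos))
    (hl : ∀ b ∈ l, b.1 ∈ O.hatPos ∧ (b.2 : L) ∈ rootSpace H b.1)
    {ν : Module.Dual ℂ H} {v : U O.nHatNeg} (hv : v ∈ O.wtPiece ν) :
    T.act (antipode L (incl O.nHatPos (l.map fun b => iota O.nHatPos b.2).prod)) v ∈
      O.wtPiece (ν - (l.map fun b => b.1.toLinear).sum) := by
  induction l generalizing ν v with
  | nil => simpa using hv
  | cons b l ih =>
    simp only [List.map_cons, List.prod_cons, List.sum_cons]
    rw [map_mul, incl_iota, antipode_mul, antipode_iota, map_mul, Module.End.mul_apply, map_neg,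
      LinearMap.neg_apply, map_neg, ← sub_sub]
    exact neg_mem (ih (fun c hc => hl c (List.mem_cons_of_mem _ hc))
      (act_mem_wtPiece T hlam (hl b List.mem_cons_self).2 hv))

/-- The pairing is orthogonal with respect to weights. -/
lemma shapovalov_eq_zero_of_ne (hlam : sharp lam ∈ H) {μ ν : Module.Dual ℂ H} (hne : μ ≠ ν)
    {a : U O.nHatPos} (ha : a ∈ weightPiece O.nHatPos O.hatPos μ) {v : U O.nHatNeg}
    (hv : v ∈ O.wtPiece ν) : O.shapovalov a v = 0 := by
  have T := O.triangular hlam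
  refine (Submodule.span_le.mpr ?_ : weightPiece O.nHatPos O.hatPos μ ≤
    LinearMap.ker (O.shapovalov.flip v)) ha
  rintro _ ⟨l, hl, rfl, rfl⟩
  change O.shapovalov _ v = 0
  rw [shapovalov_eq T]
  exact O.counit_wtPiece (sub_ne_zero.mpr hne.symm) (act_antipode_mem T hlam l hl hv)

variable (R : O.RootVectors)

lemma projNeg_wordY_mem (hlam : sharp lam ∈ H) (w : O.Word) :
    O.projNeg (R.wordY w) ∈ O.wtPiece (O.wt w) := by
  have T := O.triangular hlam
  rw [projNeg_eq T, incl_wordY]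
  exact act_prodY_one_mem R T hlam w

include R in
lemma finiteDimensional_wtPiece (hlam : sharp lam ∈ H) (hO : O.MemOmegaTilde)
    (μ : Module.Dual ℂ H) : FiniteDimensional ℂ (O.wtPiece μ) := by
  have T := O.triangular hlam
  have hfin : FiniteDimensional ℂ (Submodule.span ℂ
      ((fun w => T.act (R.prodY w) 1) '' (O.wordsOfWeight μ : Set O.Word))) :=
    FiniteDimensional.span_of_finite ℂ ((O.wordsOfWeight μ).finite_toSet.image _)
  refine Submodule.finiteDimensional_of_le (S₂ := Submodule.span ℂ
      ((fun w => T.act (R.prodY w) 1) '' (O.wordsOfWeight μ : Set O.Word))) fun v hv => ?_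
  rw [← expansion_of_mem_wtPiece R T hlam hO hv]
  exact Submodule.sum_mem _ fun w hw => Submodule.smul_mem _ _
    (Submodule.subset_span ⟨w, hw, rfl⟩)

variable (O) in
lemma countable_wtPiece_ne_bot : {μ | O.wtPiece μ ≠ ⊥}.Countable := by
  refine (Set.countable_range O.wt).mono fun μ hμ => ?_
  by_contra h
  refine hμ (O.wtPiece_eq_bot fun hc => h ?_)
  obtain ⟨w, -, hw⟩ := O.exists_word_of_mem_hatCone hc
  exact ⟨w, hw⟩

include R in
lemma shapovalov_nondegenerate (hlam : sharp lam ∈ H) (hO : O.MemOmegaTilde) :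
    O.shapovalov.Nondegenerate :=
  ⟨shapovalov_separatingLeft R hlam hO, shapovalov_separatingRight R hlam hO⟩

include R in
lemma exists_areDual (hlam : sharp lam ∈ H) (hO : O.MemOmegaTilde) :
    ∃ (I : Type) (u : Module.Basis I ℂ (U O.nHatPos)) (v : Module.Basis I ℂ (U O.nHatNeg)),
      O.AreDual u v := by
  have := finiteDimensional_wtPiece R hlam hO
  exact exists_dual_bases O.shapovalov (shapovalov_nondegenerate R hlam hO)
    (weightPiece O.nHatPos O.hatPos) O.wtPiece
    (Submodule.eq_top_iff'.mpr (mem_iSup_weightPiece rfl))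
    (Submodule.eq_top_iff'.mpr O.mem_iSup_wtPiece)
    (fun _ _ hne _ ha _ hc => shapovalov_eq_zero_of_ne hlam hne ha hc)
    O.countable_wtPiece_ne_bot

/-! ### Convergence in the completion -/

variable (O) in
lemma mem_iSup_gradedPiece (a : U O.nHatPos) : a ∈ ⨆ i : ℕ, O.gradedPiece O.nHatPos i := by
  refine (iSup_le fun μ => Submodule.span_le.mpr ?_ : (⨆ μ, weightPiece O.nHatPos O.hatPos μ) ≤ _)
    (mem_iSup_weightPiece rfl a)
  rintro _ ⟨l, hl, -, rfl⟩
  have hdeg : ∃ d : ℕ, O.HasDegree (l.map fun b => b.1.toLinear).sum d := by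
    induction l with
    | nil => exact ⟨0, O.hasDegree_zero⟩
    | cons b l ih =>
      obtain ⟨d, hd⟩ := ih fun c hc => hl c (List.mem_cons_of_mem _ hc)
      obtain ⟨e, -, he⟩ := O.exists_degree ⟨b.1, (hl b List.mem_cons_self).1⟩
      exact ⟨e + d, by simpa using he.add hd⟩
  obtain ⟨d, hd⟩ := hdeg
  exact Submodule.mem_iSup_of_mem d (Submodule.subset_span ⟨l, fun b hb => (hl b hb).2, hd, rfl⟩)

lemma tmul_mem_filtration {n j : ℕ} (hj : n ≤ j) (u : U O.nHatPos) {y : U O.nHatNeg}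
    (hy : y ∈ O.gradedPiece O.nHatNeg (-(j : ℤ))) : u ⊗ₜ[ℂ] y ∈ O.filtration n := by
  refine (iSup_le fun i a ha => ?_ : (⨆ i : ℕ, O.gradedPiece O.nHatPos i) ≤
    (O.filtration n).comap ((TensorProduct.mk ℂ _ _).flip y)) (O.mem_iSup_gradedPiece u)
  exact Submodule.subset_span ⟨i, j, by omega, a, ha, y, hy, rfl⟩

/-- For all but finitely many words `w` in `W̃`, the element `π⁻ Y_w` has degree at most `-n`: the
weight of such a `w` is a sum of positive roots of degree at least `1`. If this sum has fewer than
`n` terms, there are only finitely many possible weights, each of finitely many words. -/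
lemma exists_finset_words (hlam : sharp lam ∈ H) (n : ℕ) : ∃ s : Finset O.Word,
    ∀ w ∈ O.wordsTilde, w ∉ s → ∀ u : U O.nHatPos,
      u ⊗ₜ[ℂ] O.projNeg (R.wordY w) ∈ O.filtration n := by
  classical
  refine ⟨(List.finite_length_lt {α // α ∈ O.pos} n).toFinset.biUnion
    fun w => O.wordsOfWeight (O.wt w), fun w hw hws u => ?_⟩
  obtain ⟨w', hw', hwt⟩ := O.exists_word_of_mem_hatCone (O.wt_mem_hatCone_of_mem_wordsTilde hw)
  obtain ⟨d, hd, hdeg⟩ := O.exists_degree_wt hw'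
  have hn : n ≤ w'.length := by
    by_contra hlt
    refine hws (Finset.mem_biUnion.mpr ⟨w', ?_, mem_wordsOfWeight.mpr hwt.symm⟩)
    simpa using hlt
  rw [hwt] at hdeg
  exact tmul_mem_filtration (hn.trans hd) u
    (O.wtPiece_le_gradedPiece hdeg (projNeg_wordY_mem R hlam w))

lemma sum_mkQ_eq {V I : Type*} [AddCommGroup V] [Module ℂ V] (N : Submodule ℂ V) {t : I → V}
    {s s' : Finset I} (hs : ∀ i ∉ s, t i ∈ N) (hs' : ∀ i ∉ s', t i ∈ N) :
    ∑ i ∈ s, N.mkQ (t i) = ∑ i ∈ s', N.mkQ (t i) := by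
  classical
  exact (Finset.sum_subset (Finset.subset_union_left (s₂ := s')) fun i _ hi =>
    (Submodule.Quotient.mk_eq_zero N).mpr (hs i hi)).trans
    (Finset.sum_subset (Finset.subset_union_right (s₁ := s)) fun i _ hi =>
      (Submodule.Quotient.mk_eq_zero N).mpr (hs' i hi)).symm

lemma exists_hasFormalSum {I : Type*} {t : I → U O.nHatPos ⊗[ℂ] U O.nHatNeg}
    (ht : ∀ n, ∃ s : Finset I, ∀ i ∉ s, t i ∈ O.filtration n) : ∃ F, O.HasFormalSum t F := by
  choose s hs using ht
  refine ⟨⟨fun n => ∑ i ∈ s n, (O.filtration n).mkQ (t i), fun m n h => ?_⟩,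
    fun n => ⟨s n, hs n, rfl⟩⟩
  rw [map_sum]
  exact sum_mkQ_eq _ (fun i hi => O.filtration_antitone h (hs n i hi)) (hs m)

lemma HasFormalSum.subtype {I : Type*} {t : I → U O.nHatPos ⊗[ℂ] U O.nHatNeg}
    {F : O.CompletedTensor} (h : O.HasFormalSum t F) (S : Set I) (hS : ∀ i ∉ S, t i = 0) :
    O.HasFormalSum (fun i : S => t i) F := by
  classical
  intro n
  obtain ⟨s, hs, hsum⟩ := h n
  refine ⟨s.subtype (· ∈ S), fun i hi => hs i (by simpa using hi), ?_⟩
  rw [← hsum, Finset.sum_subtype_eq_sum_filter (f := fun i => (O.filtration n).mkQ (t i)),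
    Finset.sum_filter_of_ne]
  intro i _ hi
  by_contra hiS
  rw [hS i hiS, map_zero] at hi
  exact hi rfl

/-! ### The canonical element -/

variable (O) in
/-- The term of a word `w` in the canonical element. -/
def term (w : O.Word) : U O.nHatPos ⊗[ℂ] U O.nHatNeg :=
  O.coef w • O.projPos (R.wordX w) ⊗ₜ[ℂ] O.projNeg (R.wordY w)

lemma term_mem_filtration {n : ℕ} {s : Finset O.Word}
    (hs : ∀ w ∈ O.wordsTilde, w ∉ s → ∀ u : U O.nHatPos,
      u ⊗ₜ[ℂ] O.projNeg (R.wordY w) ∈ O.filtration n) :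
    ∀ w ∉ s, O.term R w ∈ O.filtration n := by
  intro w hw
  rw [term]
  by_cases hwt : w ∈ O.wordsTilde
  · exact Submodule.smul_mem _ _ (hs w hwt hw _)
  · rw [coef_of_notMem hwt, zero_smul]
    exact zero_mem _

lemma exists_hasFormalSum_term (hlam : sharp lam ∈ H) : ∃ F, O.HasFormalSum (O.term R) F := by
  refine exists_hasFormalSum fun n => ?_
  obtain ⟨s, hs⟩ := exists_finset_words R hlam n
  exact ⟨s, term_mem_filtration R hs⟩

/-- Modulo the part of degree at least `n`, only finitely many terms of the expansion of `v`
contribute to `u ⊗ v`. -/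
lemma tmul_sub_sum_mem_filtration (hlam : sharp lam ∈ H) (hO : O.MemOmegaTilde) {n : ℕ}
    {s : Finset O.Word} (hs : ∀ w ∈ O.wordsTilde, w ∉ s → ∀ u : U O.nHatPos,
      u ⊗ₜ[ℂ] O.projNeg (R.wordY w) ∈ O.filtration n) (u : U O.nHatPos) (v : U O.nHatNeg) :
    u ⊗ₜ[ℂ] v - ∑ w ∈ s, (O.coef w * O.shapovalov (O.projPos (R.wordX w)) v) •
      u ⊗ₜ[ℂ] O.projNeg (R.wordY w) ∈ O.filtration n := by
  classical
  obtain ⟨s', hs'⟩ := expansion R hlam hO v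
  conv =>
    enter [2, 1, 3]
    rw [← hs' (s' ∪ s) Finset.subset_union_left]
  rw [TensorProduct.tmul_sum, ← Finset.sum_sdiff (Finset.subset_union_right (s₁ := s'))]
  simp only [TensorProduct.tmul_smul, add_sub_cancel_right]
  refine Submodule.sum_mem _ fun w hw => ?_
  by_cases hwt : w ∈ O.wordsTilde
  · exact Submodule.smul_mem _ _ (hs w hwt (Finset.mem_sdiff.mp hw).2 _)
  · rw [coef_of_notMem hwt, zero_mul, zero_smul]
    exact zero_mem _

lemma AreDual.repr_eq {I : Type*} {u : Module.Basis I ℂ (U O.nHatPos)}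
    {v : Module.Basis I ℂ (U O.nHatNeg)} (h : O.AreDual u v) (x : U O.nHatPos) (i : I) :
    u.repr x i = O.shapovalov x (v i) := by
  have : u.coord i = O.shapovalov.flip (v i) := by
    refine u.ext fun j => ?_
    rw [Module.Basis.coord_apply, Module.Basis.repr_self, LinearMap.flip_apply]
    by_cases hij : j = i
    · rw [hij, Finsupp.single_eq_same, h.1]
    · rw [Finsupp.single_eq_of_ne (Ne.symm hij), h.2 j i hij]
  exact LinearMap.congr_fun this x

/-- Expanding the second factors of `∑ u_i ⊗ v_i` over words turns the sum into
`∑ c_w (∑ ⟨π⁺ X_w, v_i⟩ u_i) ⊗ π⁻ Y_w`, and the inner sum is `π⁺ X_w`. -/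
lemma AreDual.hasFormalSum (hlam : sharp lam ∈ H) (hO : O.MemOmegaTilde) {I : Type*}
    {u : Module.Basis I ℂ (U O.nHatPos)} {v : Module.Basis I ℂ (U O.nHatNeg)}
    (h : O.AreDual u v) {F : O.CompletedTensor} (hF : O.HasFormalSum (O.term R) F) :
    O.HasFormalSum (fun i => u i ⊗ₜ[ℂ] v i) F := by
  classical
  intro n
  obtain ⟨s, hs⟩ := exists_finset_words R hlam n
  let J : Finset I := s.biUnion fun w => (u.repr (O.projPos (R.wordX w))).support
  have hJ : ∀ w ∈ s, ∀ i ∉ J, O.shapovalov (O.projPos (R.wordX w)) (v i) = 0 := by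
    intro w hw i hi
    rw [← h.repr_eq]
    by_contra hne
    exact hi (Finset.mem_biUnion.mpr ⟨w, hw, Finsupp.mem_support_iff.mpr hne⟩)
  refine ⟨J, fun i hi => ?_, ?_⟩
  · have := tmul_sub_sum_mem_filtration R hlam hO hs (u i) (v i)
    rwa [Finset.sum_eq_zero, sub_zero] at this
    intro w hw
    rw [hJ w hw i hi, mul_zero, zero_smul]
  · have hX : ∀ w ∈ s, O.projPos (R.wordX w) =
        ∑ i ∈ J, O.shapovalov (O.projPos (R.wordX w)) (v i) • u i := by
      intro w hw
      conv_lhs => rw [← u.linearCombination_repr (O.projPos (R.wordX w))]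
      rw [Finsupp.linearCombination_apply, Finsupp.sum_of_support_subset (s := J)]
      · simp only [h.repr_eq]
      · exact Finset.subset_biUnion_of_mem
          (fun w => (u.repr (O.projPos (R.wordX w))).support) hw
      · simp
    obtain ⟨s', hs', hsum⟩ := hF n
    rw [← hsum, sum_mkQ_eq _ hs' (term_mem_filtration R hs), ← map_sum, ← map_sum]
    refine (Submodule.Quotient.eq _).mpr ?_
    have hterm : ∑ w ∈ s, O.term R w = ∑ i ∈ J, ∑ w ∈ s,
        (O.coef w * O.shapovalov (O.projPos (R.wordX w)) (v i)) •
          u i ⊗ₜ[ℂ] O.projNeg (R.wordY w) := by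
      rw [Finset.sum_comm]
      refine Finset.sum_congr rfl fun w hw => ?_
      rw [term]
      conv_lhs => rw [hX w hw]
      rw [TensorProduct.sum_tmul, Finset.smul_sum]
      refine Finset.sum_congr rfl fun i _ => ?_
      rw [← TensorProduct.smul_tmul', smul_smul]
    rw [hterm, ← Finset.sum_sub_distrib]
    exact Submodule.sum_mem _ fun i _ => tmul_sub_sum_mem_filtration R hlam hO hs (u i) (v i)

end InvariantOrdering

end Canonical

end Shapovalov

end

theorem mainTheorem3 {L : Type*} [LieRing L] [LieAlgebra ℂ L] [FiniteDimensional ℂ L]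
    [LieAlgebra.IsSemisimple ℂ L] (H : LieSubalgebra ℂ L) [H.IsCartanSubalgebra]
    (lam : Module.Dual ℂ L) (hlam : Shapovalov.sharp lam ∈ H)
    (O : Shapovalov.InvariantOrdering H lam) (hO : O.MemOmegaTilde) (R : O.RootVectors) :
    O.shapovalov.Nondegenerate ∧
    (∀ w ∈ O.wordsTilde, O.pWord w (O.wt w) ≠ 0) ∧
    ∃ F : O.CompletedTensor, O.IsCanonicalElement F ∧
      O.HasFormalSum (fun w : O.wordsTilde =>
        (O.pWord w.1 (O.wt w.1))⁻¹ •
          TensorProduct.tmul ℂ (O.projPos (R.wordX w.1)) (O.projNeg (R.wordY w.1))) F ∧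
      O.HasFormalSum (fun w : O.wordsTilde =>
        (∏ i ∈ Finset.range w.1.length, (O.p (O.wt (w.1.drop i)))⁻¹) •
          TensorProduct.tmul ℂ (O.projPos (R.wordX w.1)) (O.projNeg (R.wordY w.1))) F := by
  refine ⟨Shapovalov.InvariantOrdering.shapovalov_nondegenerate R hlam hO, fun w hw => ?_, ?_⟩
  · rw [O.pWord_wt, Finset.prod_ne_zero_iff]
    exact fun i hi => O.p_wt_ne_zero hO hw (Finset.mem_range.mp hi)
  · obtain ⟨F, hF⟩ := Shapovalov.InvariantOrdering.exists_hasFormalSum_term R hlam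
    have h2 : O.HasFormalSum (fun w : O.wordsTilde =>
        (∏ i ∈ Finset.range w.1.length, (O.p (O.wt (w.1.drop i)))⁻¹) •
          TensorProduct.tmul ℂ (O.projPos (R.wordX w.1)) (O.projNeg (R.wordY w.1))) F := by
      convert hF.subtype O.wordsTilde fun w hw => ?_ using 2 with w
      · rw [Shapovalov.InvariantOrdering.term, Shapovalov.InvariantOrdering.coef_of_mem w.2]
      · rw [Shapovalov.InvariantOrdering.term, Shapovalov.InvariantOrdering.coef_of_notMem hw,
          zero_smul]
    refine ⟨F, ⟨Shapovalov.InvariantOrdering.exists_areDual R hlam hO, fun I u v h =>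
      h.hasFormalSum R hlam hO hF⟩, ?_, h2⟩
    simpa only [O.pWord_wt, Finset.prod_inv_distrib] using h2
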